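/- Let $k$ be a field, let $H$ be a finite group acting by automorphisms on a group $\Gamma$ (written $h.r$), let $k^H$ be the Hopf algebra of functions on $H$ with basis $(\delta_h)_{h\in H}$, and let $k[\Gamma]\rtimes k^H$ be the smash coproduct Hopf algebra: it is $k[\Gamma]\otimes k^H$ as an algebra, with $$\Delta(r\#\delta_h)=\sum_{l\in H}r\#\delta_{l^{-1}}\otimes l.r\#\delta_{lh},\quad \varepsilon(r\#\delta_h)=\delta_{h,1},\quad S(r\#\delta_h)=h^{-1}.r^{-1}\#\delta_{h^{-1}}.$$ A factorization of an algebra map $\rho:A\to R$ from a Hopf algebra $A$ to an algebra $R$ is a triple $(L,q,\varphi)$ with $L$ a Hopf algebra, $q:A\to L$ a surjective Hopf algebra map and $\varphi:L\to R$ an algebra map with $\varphi q=\rho$. The Hopf image of $\rho$ is the final factorization: a factorization $(A_\rho,p,\tilde\rho)$ such that for every factorization $(L,q,\varphi)$ there is a unique Hopf algebra map $f:L\to A_\rho$ with $fq=p$ and $\tilde\rho f=\varphi$. The map $\rho$ is inner faithful if $(A,\mathrm{id}_A,\rho)$ is the Hopf image of $\rho$. A quotient datum $(N,\Phi)$ consists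 of a normal $H$-stable subgroup $N$ of $\Gamma$ and a group morphism $\Phi:N\to(k^H)^\times$ with $\Phi(r)(lh)=\Phi(l^{-1}.r)(h)\,\Phi(r)(l)$ and $\Phi(srs^{-1})=\Phi(r)$ for $r\in N$, $s\in\Gamma$, $h,l\in H$. Let $u:\Gamma\to\Gamma/N$ be the projection. Given a section $j$ of $u$ with $ju(1)=1$, the Hopf algebra $k[\Gamma/N]\rtimes_\Phi k^H$ is $k[\Gamma/N]\otimes k^H$ with unit $1\#1$, counit $\varepsilon(u(r)\#\delta_h)=\delta_{h,1}$, and $$(u(r)\#\delta_h)(u(s)\#\delta_l)=u(rs)\#\delta_h\delta_l\,\Phi(ju(r)ju(s)ju(rs)^{-1}),$$ $$\Delta(u(r)\#\delta_h)=\sum_{l\in H}(u(r)\#\delta_{l^{-1}})\otimes \big(u(l.r)\#\delta_{lh}\,\Phi((l.ju(r))\,ju(l.r)^{-1})\big),$$ $$S(u(r)\#\delta_h)=u(h^{-1}.r^{-1})\#\Phi\big(ju(h^{-1}.r^{-1})^{-1}\,(h^{-1}.ju(r)^{-1})\big)\delta_{h^{-1}}.$$ Let $R$ be a $k$-algebra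 and let $\rho:k[\Gamma]\rtimes k^H\to R$ be an algebra map whose restriction to $k^H$ is inner faithful. Let $\mathcal E(\rho)$ be the set of quotient data $(N,\Phi)$ with $\rho(r\#1)=\rho(1\#\Phi(r))$ for all $r\in N$, partially ordered by $(N,\Phi)\le(M,\Psi)\iff N\subset M$ and $\Psi_{|N}=\Phi$. Then: 1. For every $(N,\Phi)\in\mathcal E(\rho)$ and every section $j$ as above, there is a factorization $\rho=\tilde\rho q$ through $k[\Gamma/N]\rtimes_\Phi k^H$, with $q(r\#\delta_h)=u(r)\#\delta_h\Phi(r\,ju(r)^{-1})$ a surjective Hopf algebra map and $\tilde\rho(u(r)\#\delta_h)=\rho(ju(r)\#\delta_h)$ an algebra map. 2. $\mathcal E(\rho)$ has a maximal element. 3. For every maximal $(N,\Phi)\in\mathcal E(\rho)$ and every such $j$, the factorization in 1 is universal: $(k[\Gamma/N]\rtimes_\Phi k^H,q,\tilde\rho)$ is the Hopf image of $\rho$. -/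

import Mathlib

open scoped TensorProduct

universe w

noncomputable section

/-- The underlying vector space `k^H` of functions on `H`. -/
def FunAlg (k H : Type*) : Type _ := H → k

namespace FunAlg

variable {k H : Type*} [Field k]

instance : CommRing (FunAlg k H) := inferInstanceAs (CommRing (H → k))
instance : Algebra k (FunAlg k H) := inferInstanceAs (Algebra k (H → k))

/-- The element of `k^H` given by a function. -/
def mk {k H : Type*} (f : H → k) : FunAlg k H := f

/-- The value of an element of `k^H` at a point. -/
def eval {k H : Type*} (f : FunAlg k H) (x : H) : k := f x

instance {k H : Type*} : CoeFun (FunAlg k H) (fun _ => H → k) := ⟨eval⟩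

@[ext] theorem ext {k H : Type*} {f g : FunAlg k H} (h : ∀ x : H, f x = g x) : f = g := funext h
@[simp] theorem mk_apply {k H : Type*} (f : H → k) (x : H) : mk f x = f x := rfl
@[simp] theorem zero_apply (x : H) : (0 : FunAlg k H) x = 0 := rfl
@[simp] theorem mul_apply (f g : FunAlg k H) (x : H) : (f * g) x = f x * g x := rfl
@[simp] theorem add_apply (f g : FunAlg k H) (x : H) : (f + g) x = f x + g x := rfl
@[simp] theorem one_apply (x : H) : (1 : FunAlg k H) x = 1 := rfl
@[simp] theorem smul_apply (c : k) (f : FunAlg k H) (x : H) : (c • f) x = c * f x := rfl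

section Delta

variable [DecidableEq H]

/-- The function `δ_h`, equal to `1` at `h` and to `0` elsewhere. -/
def delta (k : Type*) [Field k] {H : Type*} [DecidableEq H] (h : H) : FunAlg k H :=
  mk fun x => if x = h then 1 else 0

@[simp] theorem delta_apply (h x : H) : delta k h x = if x = h then 1 else 0 := rfl

@[simp] theorem delta_mul (h l : H) :
    delta k h * delta k l = if h = l then delta k h else 0 := by
  ext x
  by_cases hl : h = l
  · subst hl; simp
  · simp only [hl, if_false, mul_apply, delta_apply]
    rw [zero_apply]
    split_ifs <;> simp_all

variable [Fintype H]

theorem eq_sum (f : FunAlg k H) : f = ∑ h : H, f h • delta k h := by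
  ext x
  let ev : FunAlg k H →ₗ[k] k :=
    { toFun := fun g => g x, map_add' := fun _ _ => rfl, map_smul' := fun _ _ => rfl }
  have hev : ∀ g : FunAlg k H, ev g = g x := fun _ => rfl
  rw [← hev (∑ h : H, f h • delta k h), map_sum, Finset.sum_eq_single x]
  · simp [hev]
  · intro b _ hb
    simp [hev, Ne.symm hb]
  · simp

theorem lin_ext {M : Type*} [AddCommMonoid M] [Module k M] {φ ψ : FunAlg k H →ₗ[k] M}
    (h : ∀ x, φ (delta k x) = ψ (delta k x)) : φ = ψ := by
  ext f
  rw [eq_sum f]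
  simp [h]

theorem sum_delta : ∑ h : H, delta k h = 1 := by
  have := eq_sum (1 : FunAlg k H)
  simpa using this.symm

end Delta

section Hopf

variable [Group H]

/-- The counit `f ↦ f(1)`. -/
def counitLin (k H : Type*) [Field k] [Group H] : FunAlg k H →ₗ[k] k where
  toFun f := f 1
  map_add' _ _ := rfl
  map_smul' _ _ := rfl

/-- The antipode `S(f)(h) = f(h⁻¹)`. -/
def antipodeLin (k H : Type*) [Field k] [Group H] : FunAlg k H →ₗ[k] FunAlg k H where
  toFun f := mk fun h => f h⁻¹
  map_add' _ _ := rfl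
  map_smul' _ _ := rfl

variable [DecidableEq H]

theorem antipodeLin_delta (h : H) : antipodeLin k H (delta k h) = delta k h⁻¹ := by
  ext x
  change (if x⁻¹ = h then (1 : k) else 0) = if x = h⁻¹ then 1 else 0
  simp [inv_eq_iff_eq_inv]

theorem counitLin_delta (h : H) : counitLin k H (delta k h) = if h = 1 then 1 else 0 := by
  change (if 1 = h then (1 : k) else 0) = _
  simp [eq_comm]

variable [Fintype H]

/-- The comultiplication of `k^H`, dual to the multiplication of `k[H]`:
`Δ(f) = ∑_{l,m} f(lm) δ_l ⊗ δ_m`. -/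
def comulLin (k H : Type*) [Field k] [Group H] [Fintype H] [DecidableEq H] :
    FunAlg k H →ₗ[k] FunAlg k H ⊗[k] FunAlg k H where
  toFun f := ∑ l : H, ∑ m : H, f (l * m) • (delta k l ⊗ₜ[k] delta k m)
  map_add' f g := by simp [add_smul, Finset.sum_add_distrib]
  map_smul' c f := by simp [mul_smul, Finset.smul_sum]

theorem comulLin_delta (h : H) :
    comulLin k H (delta k h) = ∑ l : H, delta k l ⊗ₜ[k] delta k (l⁻¹ * h) := by
  simp only [comulLin, LinearMap.coe_mk, AddHom.coe_mk, delta_apply]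
  refine Finset.sum_congr rfl fun l _ => ?_
  rw [Finset.sum_eq_single (l⁻¹ * h)]
  · simp
  · intro m _ hm
    rw [if_neg, zero_smul]
    rintro rfl; simp at hm
  · simp

instance : Coalgebra k (FunAlg k H) where
  comul := comulLin k H
  counit := counitLin k H
  coassoc := by
    refine lin_ext fun h => ?_
    simp only [LinearMap.coe_comp, Function.comp_apply, LinearEquiv.coe_coe, comulLin_delta,
      map_sum, LinearMap.rTensor_tmul, LinearMap.lTensor_tmul, TensorProduct.sum_tmul,
      TensorProduct.tmul_sum, TensorProduct.assoc_tmul]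
    rw [Finset.sum_comm]
    refine Finset.sum_congr rfl fun l _ => ?_
    rw [← Equiv.sum_comp (Equiv.mulLeft l)]
    simp [mul_assoc]
  rTensor_counit_comp_comul := by
    refine lin_ext fun h => ?_
    simp [comulLin_delta, counitLin_delta, TensorProduct.ite_tmul]
  lTensor_counit_comp_comul := by
    refine lin_ext fun h => ?_
    simp [comulLin_delta, counitLin_delta, TensorProduct.tmul_ite, inv_mul_eq_one]

theorem comul_delta (h : H) : CoalgebraStruct.comul (R := k) (delta k h) =
    ∑ l : H, delta k l ⊗ₜ[k] delta k (l⁻¹ * h) := comulLin_delta h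

theorem counit_apply (f : FunAlg k H) : CoalgebraStruct.counit (R := k) f = f 1 := rfl

instance : Bialgebra k (FunAlg k H) where
  counit_one := rfl
  mul_compr₂_counit := by ext; rfl
  comul_one := by
    change comulLin k H 1 = 1
    simp only [comulLin, LinearMap.coe_mk, AddHom.coe_mk, one_apply, one_smul,
      ← TensorProduct.tmul_sum, ← TensorProduct.sum_tmul, sum_delta]
    rfl
  mul_compr₂_comul := by
    refine lin_ext fun h => lin_ext fun m => ?_
    change comulLin k H (delta k h * delta k m) =
      comulLin k H (delta k h) * comulLin k H (delta k m)
    simp only [comulLin_delta, Finset.sum_mul_sum, Algebra.TensorProduct.tmul_mul_tmul, delta_mul,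
      TensorProduct.ite_tmul]
    simp only [Finset.sum_ite_eq, Finset.mem_univ, if_true, mul_right_inj]
    by_cases hm : h = m
    · subst hm; simp [comulLin_delta]
    · simp [hm]

instance : HopfAlgebra k (FunAlg k H) where
  antipode := antipodeLin k H
  mul_antipode_rTensor_comul := by
    refine lin_ext fun h => ?_
    simp only [LinearMap.coe_comp, Function.comp_apply, comul_delta, map_sum,
      LinearMap.rTensor_tmul, LinearMap.mul'_apply, antipodeLin_delta, delta_mul, counit_apply,
      left_eq_mul, Algebra.linearMap_apply, delta_apply]
    by_cases hh : h = 1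
    · subst hh
      simp only [if_true, map_one, ← sum_delta]
      exact Equiv.sum_comp (Equiv.inv H) (delta k)
    · simp [hh, Ne.symm hh]
  mul_antipode_lTensor_comul := by
    refine lin_ext fun h => ?_
    simp only [LinearMap.coe_comp, Function.comp_apply, comul_delta, map_sum,
      LinearMap.lTensor_tmul, LinearMap.mul'_apply, antipodeLin_delta, delta_mul, counit_apply,
      mul_inv_rev, inv_inv, right_eq_mul, inv_eq_one, Algebra.linearMap_apply, delta_apply]
    by_cases hh : h = 1
    · subst hh
      simp [sum_delta]
    · simp [hh, Ne.symm hh]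

end Hopf

end FunAlg
/-- Data for a Hopf algebra on the vector space with basis `x # δ_h` (`x ∈ Q`, `h ∈ H`): an action
of `H` on `Q` by automorphisms, and scalar functions `σ` (product), `τ` (coproduct) and `ω`
(antipode), subject to the compatibilities that make the structure maps below a Hopf algebra.
This is only a common device for constructing the smash coproduct (where `σ = τ = ω = 1`) and
the Hopf algebra of a quotient datum. -/
structure CrossedDatum (k Q H : Type*) [Field k] [Group Q] [Group H] where
  act : H →* MulAut Q
  σ : Q → Q → H → k
  τ : H → Q → H → k
  ω : Q → H → k
  σ_assoc : ∀ x y z h, σ x y h * σ (x * y) z h = σ y z h * σ x (y * z) h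
  σ_one_left : ∀ x h, σ 1 x h = 1
  σ_one_right : ∀ x h, σ x 1 h = 1
  σ_counit : ∀ x y, σ x y 1 = 1
  τ_one : ∀ x h, τ 1 x h = 1
  τ_counit : ∀ l x, τ l x 1 = 1
  τ_unit : ∀ l h, τ l 1 h = 1
  τ_coassoc : ∀ m n x h,
    τ m x n⁻¹ * τ (n * m) x (n * m * h) = τ n (act m x) (n * m * h) * τ m x (m * h)
  σ_τ : ∀ l x y h, σ x y h * τ l (x * y) (l * h) =
    σ x y l⁻¹ * σ (act l x) (act l y) (l * h) * (τ l x (l * h) * τ l y (l * h))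
  ω_left : ∀ l x, ω x l⁻¹ * σ (act l x⁻¹) (act l x) l * τ l x l = 1
  ω_right : ∀ l x, σ x x⁻¹ l⁻¹ * ω (act l x) l * τ l x l = 1

namespace CrossedDatum

variable {k Q H : Type*} [Field k] [Group Q] [Group H]

/-- The vector space with basis `x # δ_h`, for `x ∈ Q` and `h ∈ H`. -/
def Alg (_D : CrossedDatum k Q H) : Type _ := Q × H →₀ k

variable (D : CrossedDatum k Q H)

instance : AddCommGroup D.Alg := inferInstanceAs (AddCommGroup (Q × H →₀ k))
instance : Module k D.Alg := inferInstanceAs (Module k (Q × H →₀ k))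

/-- The basis element `x # δ_h`. -/
def basis (x : Q) (h : H) : D.Alg := Finsupp.single (x, h) (1 : k)

/-- The linear map with prescribed values on the basis. -/
def lift {M : Type*} [AddCommGroup M] [Module k M] (v : Q → H → M) : D.Alg →ₗ[k] M :=
  Finsupp.linearCombination k (fun p : Q × H => v p.1 p.2)

@[simp] theorem lift_basis {M : Type*} [AddCommGroup M] [Module k M] (v : Q → H → M)
    (x : Q) (h : H) : D.lift v (D.basis x h) = v x h := by
  change Finsupp.linearCombination k (fun p : Q × H => v p.1 p.2) (Finsupp.single (x, h) 1) = _
  simp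

variable {D} in
theorem lin_ext {M : Type*} [AddCommMonoid M] [Module k M] {φ ψ : D.Alg →ₗ[k] M}
    (h : ∀ x l, φ (D.basis x l) = ψ (D.basis x l)) : φ = ψ :=
  Finsupp.lhom_ext' (M := k) (φ := φ) (ψ := ψ) fun p => LinearMap.ext_ring (h p.1 p.2)

section Unit

variable [Fintype H]

/-- The element `x # f`, for `x ∈ Q` and `f ∈ k^H`. -/
def tmul (x : Q) (f : FunAlg k H) : D.Alg := ∑ h : H, f h • D.basis x h

instance : One D.Alg := ⟨D.tmul 1 1⟩

theorem one_def : (1 : D.Alg) = ∑ h : H, D.basis 1 h := by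
  change D.tmul 1 1 = _
  simp [tmul]

end Unit

variable [DecidableEq H]

/-- The product: `(x # δ_h)(y # δ_l) = xy # σ(x,y) δ_h δ_l`. -/
def mulLin : D.Alg →ₗ[k] D.Alg →ₗ[k] D.Alg :=
  D.lift fun x h => D.lift fun y l => if h = l then D.σ x y h • D.basis (x * y) h else 0

instance : Mul D.Alg := ⟨fun a b => D.mulLin a b⟩

theorem mul_def (a b : D.Alg) : a * b = D.mulLin a b := rfl

theorem basis_mul (x y : Q) (h l : H) : D.basis x h * D.basis y l =
    if h = l then D.σ x y h • D.basis (x * y) h else 0 := by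
  simp [mul_def, mulLin]

theorem mul_assoc_aux (a b c : D.Alg) : a * b * c = a * (b * c) := by
  suffices h : D.mulLin.compr₂ D.mulLin =
      (LinearMap.llcomp k D.Alg D.Alg D.Alg ∘ₗ D.mulLin).compl₂ D.mulLin from
    LinearMap.congr_fun (LinearMap.congr_fun (LinearMap.congr_fun h a) b) c
  refine lin_ext fun x h => lin_ext fun y l => lin_ext fun z m => ?_
  change D.basis x h * D.basis y l * D.basis z m = D.basis x h * (D.basis y l * D.basis z m)
  have h0 : ∀ a : D.Alg, 0 * a = 0 := fun a => by simp [mul_def]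
  have h0' : ∀ a : D.Alg, a * 0 = 0 := fun a => by simp [mul_def]
  have h1 : ∀ (c : k) (a b : D.Alg), (c • a) * b = c • (a * b) := fun c a b => by simp [mul_def]
  have h2 : ∀ (c : k) (a b : D.Alg), a * (c • b) = c • (a * b) := fun c a b => by simp [mul_def]
  by_cases hl : h = l
  · subst hl
    by_cases hm : h = m
    · subst hm
      simp [basis_mul, h1, h2, smul_smul, D.σ_assoc, mul_assoc]
    · simp [basis_mul, h1, h0', hm]
  · by_cases hm : l = m
    · subst hm
      simp [basis_mul, h0, h2, hl]
    · simp [basis_mul, h0, h0', hl, hm]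

variable [Fintype H]

theorem one_mul_aux (a : D.Alg) : 1 * a = a := by
  suffices h : D.mulLin 1 = LinearMap.id from LinearMap.congr_fun h a
  refine lin_ext fun x h => ?_
  rw [one_def, map_sum, LinearMap.sum_apply]
  simp only [← mul_def, basis_mul, D.σ_one_left]
  simp

theorem mul_one_aux (a : D.Alg) : a * 1 = a := by
  suffices h : D.mulLin.flip 1 = LinearMap.id from LinearMap.congr_fun h a
  refine lin_ext fun x h => ?_
  rw [LinearMap.flip_apply, one_def, map_sum]
  simp only [← mul_def, basis_mul, D.σ_one_right]
  simp

instance : Ring D.Alg where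
  __ := (inferInstance : AddCommGroup D.Alg)
  mul_assoc := D.mul_assoc_aux
  one_mul := D.one_mul_aux
  mul_one := D.mul_one_aux
  zero_mul a := by simp [mul_def]
  mul_zero a := by simp [mul_def]
  left_distrib a b c := by simp [mul_def]
  right_distrib a b c := by simp [mul_def]

instance : Algebra k D.Alg :=
  Algebra.ofModule (fun c a b => by simp [mul_def]) (fun c a b => by simp [mul_def])

/-- The counit: `ε(x # δ_h) = δ_{h,1}`. -/
def counitLin : D.Alg →ₗ[k] k := D.lift fun _ h => if h = 1 then 1 else 0

/-- The coproduct: `Δ(x # δ_h) = ∑_l (x # δ_{l⁻¹}) ⊗ (l.x # τ_l(x) δ_{lh})`. -/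
def comulLin : D.Alg →ₗ[k] D.Alg ⊗[k] D.Alg :=
  D.lift fun x h => ∑ l : H,
    D.basis x l⁻¹ ⊗ₜ[k] (D.τ l x (l * h) • D.basis (D.act l x) (l * h))

/-- The antipode: `S(x # δ_h) = ω(x)(h) (h⁻¹.x⁻¹ # δ_{h⁻¹})`. -/
def antipodeLin : D.Alg →ₗ[k] D.Alg :=
  D.lift fun x h => D.ω x h • D.basis (D.act h⁻¹ x⁻¹) h⁻¹

instance : Coalgebra k D.Alg where
  comul := D.comulLin
  counit := D.counitLin
  coassoc := by
    refine lin_ext fun x h => ?_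
    simp only [LinearMap.coe_comp, Function.comp_apply, LinearEquiv.coe_coe, comulLin, lift_basis,
      map_sum, LinearMap.rTensor_tmul, LinearMap.lTensor_tmul, TensorProduct.sum_tmul,
      TensorProduct.tmul_sum, TensorProduct.assoc_tmul, map_smul, TensorProduct.tmul_smul,
      TensorProduct.smul_tmul', Finset.smul_sum, smul_smul]
    rw [Finset.sum_comm]
    refine Finset.sum_congr rfl fun m _ => ?_
    rw [← Equiv.sum_comp (Equiv.mulRight m)]
    refine Finset.sum_congr rfl fun n _ => ?_
    have h1 := D.τ_coassoc m n x h
    simp only [Equiv.coe_mulRight, mul_inv_rev, mul_inv_cancel_left, map_mul, MulAut.mul_apply]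
    rw [mul_comm, h1, mul_comm, mul_assoc, ← TensorProduct.smul_tmul', ← TensorProduct.smul_tmul',
      ← TensorProduct.smul_tmul', TensorProduct.tmul_smul, smul_smul]
  rTensor_counit_comp_comul := by
    refine lin_ext fun x h => ?_
    simp [comulLin, counitLin, TensorProduct.ite_tmul, D.τ_one]
  lTensor_counit_comp_comul := by
    refine lin_ext fun x h => ?_
    simp only [comulLin, counitLin, LinearMap.coe_comp, Function.comp_apply, lift_basis, map_sum,
      LinearMap.lTensor_tmul, map_smul]
    rw [Finset.sum_eq_single h⁻¹]
    · simp [D.τ_counit]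
    · intro l _ hl
      rw [if_neg, smul_zero, TensorProduct.tmul_zero]
      rwa [mul_eq_one_iff_eq_inv]
    · simp

theorem comul_basis (x : Q) (h : H) : CoalgebraStruct.comul (R := k) (D.basis x h) =
    ∑ l : H, D.basis x l⁻¹ ⊗ₜ[k] (D.τ l x (l * h) • D.basis (D.act l x) (l * h)) :=
  D.lift_basis _ _ _

theorem counit_basis (x : Q) (h : H) : CoalgebraStruct.counit (R := k) (D.basis x h) =
    if h = 1 then 1 else 0 :=
  D.lift_basis _ _ _

instance : Bialgebra k D.Alg where
  counit_one := by simp [one_def, counit_basis]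
  mul_compr₂_counit := by
    refine lin_ext fun x h => lin_ext fun y l => ?_
    simp only [LinearMap.compr₂_apply, LinearMap.mul_apply', LinearMap.compl₁₂_apply, counit_basis,
      basis_mul]
    by_cases hl : h = l
    · subst hl
      by_cases h1 : h = 1
      · subst h1; simp [counit_basis, D.σ_counit]
      · simp [counit_basis, h1]
    · simp only [hl, if_false, map_zero]
      split_ifs <;> simp_all
  comul_one := by
    rw [one_def, map_sum]
    simp only [comul_basis, D.τ_unit, map_one, one_smul]
    rw [Finset.sum_comm]
    simp only [← TensorProduct.tmul_sum]
    have : ∀ l : H, ∑ h : H, D.basis 1 (l * h) = 1 := fun l => by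
      rw [one_def]; exact Equiv.sum_comp (Equiv.mulLeft l) (D.basis 1)
    simp only [this, ← TensorProduct.sum_tmul]
    have hinv : ∑ l : H, D.basis 1 l⁻¹ = 1 := by
      rw [one_def]; exact Equiv.sum_comp (Equiv.inv H) (D.basis 1)
    rw [hinv]
    rfl
  mul_compr₂_comul := by
    refine lin_ext fun x h => lin_ext fun y m => ?_
    simp only [LinearMap.compr₂_apply, LinearMap.mul_apply', LinearMap.compl₁₂_apply, comul_basis,
      basis_mul, Finset.sum_mul_sum, Algebra.TensorProduct.tmul_mul_tmul, inv_inj,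
      TensorProduct.ite_tmul, Finset.sum_ite_eq, Finset.mem_univ, if_true, smul_mul_smul_comm,
      mul_right_inj]
    by_cases hm : h = m
    · subst hm
      simp only [if_true, map_smul, comul_basis, Finset.smul_sum, TensorProduct.tmul_smul,
        TensorProduct.smul_tmul', smul_smul, map_mul]
      refine Finset.sum_congr rfl fun l _ => ?_
      rw [D.σ_τ]
      congr 2
      ring
    · simp [hm]

instance : HopfAlgebra k D.Alg where
  antipode := D.antipodeLin
  mul_antipode_rTensor_comul := by
    refine lin_ext fun x h => ?_
    simp only [LinearMap.coe_comp, Function.comp_apply, comul_basis, map_sum,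
      LinearMap.rTensor_tmul, LinearMap.mul'_apply, antipodeLin, lift_basis, counit_basis,
      smul_mul_smul_comm, basis_mul, inv_inv, left_eq_mul, Algebra.linearMap_apply]
    by_cases hh : h = 1
    · subst hh
      simp only [if_true, map_one, one_def, mul_one, smul_smul, ← map_mul, inv_mul_cancel]
      refine Finset.sum_congr rfl fun l _ => ?_
      rw [mul_right_comm, D.ω_left, one_smul]
    · simp [hh]
  mul_antipode_lTensor_comul := by
    refine lin_ext fun x h => ?_
    simp only [LinearMap.coe_comp, Function.comp_apply, comul_basis, map_sum,
      LinearMap.lTensor_tmul, LinearMap.mul'_apply, antipodeLin, lift_basis, counit_basis, map_smul,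
      mul_smul_comm, basis_mul, mul_inv_rev, right_eq_mul, inv_eq_one, Algebra.linearMap_apply]
    by_cases hh : h = 1
    · subst hh
      simp only [if_true, map_one, one_def, mul_one, smul_smul, inv_one, one_mul, map_inv,
        MulAut.inv_apply_self, mul_inv_cancel]
      rw [← Equiv.sum_comp (Equiv.inv H)]
      refine Finset.sum_congr rfl fun l _ => ?_
      have hω := D.ω_right l⁻¹ x
      simp at hω ⊢
      rw [show D.τ l⁻¹ x l⁻¹ * (D.ω ((MulEquiv.symm (D.act l)) x) l⁻¹ * D.σ x x⁻¹ l) = 1 by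
        rw [← hω]; ring, one_smul]
    · simp [hh]

theorem antipode_basis (x : Q) (h : H) : HopfAlgebraStruct.antipode k (D.basis x h) =
    D.ω x h • D.basis (D.act h⁻¹ x⁻¹) h⁻¹ := by
  change D.antipodeLin _ = _
  rw [antipodeLin, lift_basis]

/-- The linear map `f ↦ 1 # f`. -/
def inclLin : FunAlg k H →ₗ[k] D.Alg where
  toFun f := D.tmul 1 f
  map_add' f g := by simp [tmul, add_smul, Finset.sum_add_distrib]
  map_smul' c f := by simp [tmul, mul_smul, Finset.smul_sum]

/-- The algebra embedding `k^H → D.Alg`, `f ↦ 1 # f`. -/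
def incl : FunAlg k H →ₐ[k] D.Alg :=
  AlgHom.ofLinearMap D.inclLin rfl fun f g => by
    change D.tmul 1 (f * g) = D.tmul 1 f * D.tmul 1 g
    simp [tmul, Finset.sum_mul_sum, basis_mul, smul_smul, mul_comm, D.σ_one_left]

theorem incl_apply (f : FunAlg k H) : D.incl f = D.tmul 1 f := rfl

end CrossedDatum

section Smash

variable (k Γ H : Type*) [Field k] [Group Γ] [Group H] [MulDistribMulAction H Γ]

/-- The crossed datum with trivial `σ`, `τ`, `ω`. -/
def smashDatum : CrossedDatum k Γ H where
  act := MulDistribMulAction.toMulAut H Γ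
  σ _ _ _ := 1
  τ _ _ _ := 1
  ω _ _ := 1
  σ_assoc _ _ _ _ := rfl
  σ_one_left _ _ := rfl
  σ_one_right _ _ := rfl
  σ_counit _ _ := rfl
  τ_one _ _ := rfl
  τ_counit _ _ := rfl
  τ_unit _ _ := rfl
  τ_coassoc _ _ _ _ := rfl
  σ_τ _ _ _ _ := by simp
  ω_left _ _ := by simp
  ω_right _ _ := by simp

/-- The smash coproduct Hopf algebra `k[Γ] ⋊ k^H`. Its structure maps are made explicit in the
lemmas below. -/
abbrev SmashCoproduct : Type _ := (smashDatum k Γ H).Alg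

namespace SmashCoproduct

variable {Γ H}

/-- The basis element `r # δ_h` of `k[Γ] ⋊ k^H`. -/
abbrev basis (r : Γ) (h : H) : SmashCoproduct k Γ H := (smashDatum k Γ H).basis r h

theorem one_eq [Fintype H] :
    (1 : SmashCoproduct k Γ H) = (smashDatum k Γ H).tmul 1 1 := rfl

variable [DecidableEq H]

theorem basis_mul_basis (r s : Γ) (h l : H) :
    basis k r h * basis k s l = if h = l then basis k (r * s) h else 0 := by
  rw [CrossedDatum.basis_mul]
  split_ifs
  · exact one_smul k _
  · rfl

variable [Fintype H]

variable {k} in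
/-- The element `r # f` of `k[Γ] ⋊ k^H`, for `r ∈ Γ` and `f ∈ k^H`. -/
abbrev tmul (r : Γ) (f : FunAlg k H) : SmashCoproduct k Γ H := (smashDatum k Γ H).tmul r f

variable (Γ H) in
/-- The embedding `k^H → k[Γ] ⋊ k^H`, `f ↦ 1 # f`. -/
abbrev incl : FunAlg k H →ₐ[k] SmashCoproduct k Γ H := (smashDatum k Γ H).incl

theorem comul_basis (r : Γ) (h : H) : CoalgebraStruct.comul (R := k) (basis k r h) =
    ∑ l : H, basis k r l⁻¹ ⊗ₜ[k] basis k (l • r) (l * h) := by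
  rw [CrossedDatum.comul_basis]
  exact Finset.sum_congr rfl fun l _ => congrArg _ (one_smul k _)

theorem counit_basis (r : Γ) (h : H) : CoalgebraStruct.counit (R := k) (basis k r h) =
    if h = 1 then 1 else 0 := CrossedDatum.counit_basis _ _ _

theorem antipode_basis (r : Γ) (h : H) : HopfAlgebraStruct.antipode k (basis k r h) =
    basis k (h⁻¹ • r⁻¹) h⁻¹ := by
  rw [CrossedDatum.antipode_basis]
  exact one_smul k _

end SmashCoproduct

end Smash

/-- A quotient datum `(N, Φ)` (with full subgroup `H`) for `H` acting on `Γ`: a normal `H`-stable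
subgroup `N` of `Γ` and a group morphism `Φ : N → (k^H)ˣ` with
`Φ(r)(lh) = Φ(l⁻¹.r)(h) Φ(r)(l)` and `Φ(s r s⁻¹) = Φ(r)`. -/
structure QuotientDatum (k Γ H : Type*) [Field k] [Group Γ] [Group H]
    [MulDistribMulAction H Γ] where
  N : Subgroup Γ
  normal : N.Normal
  stable : ∀ (h : H) (r : Γ), r ∈ N → h • r ∈ N
  Φ : N →* (FunAlg k H)ˣ
  Φ_mul : ∀ (r : N) (l h : H), (Φ r : FunAlg k H) (l * h) =
    (Φ ⟨l⁻¹ • (r : Γ), stable l⁻¹ r r.2⟩ : FunAlg k H) h * (Φ r : FunAlg k H) l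
  Φ_conj : ∀ (r : N) (s : Γ), Φ r = Φ ⟨s * r * s⁻¹, normal.conj_mem r r.2 s⟩

namespace QuotientDatum

variable {k Γ H : Type*} [Field k] [Group Γ] [Group H] [MulDistribMulAction H Γ]

instance (D : QuotientDatum k Γ H) : D.N.Normal := D.normal

/-- The order by extension: `(N, Φ) ≤ (M, Ψ)` iff `N ⊆ M` and `Ψ` restricts to `Φ` on `N`. -/
instance : PartialOrder (QuotientDatum k Γ H) where
  le D E := ∃ hN : D.N ≤ E.N, ∀ r : D.N, E.Φ ⟨r, hN r.2⟩ = D.Φ r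
  le_refl D := ⟨le_refl _, fun _ => rfl⟩
  le_trans D E F := fun ⟨h1, h2⟩ ⟨h3, h4⟩ =>
    ⟨h1.trans h3, fun r => (h4 ⟨r, h1 r.2⟩).trans (h2 r)⟩
  le_antisymm D E := by
    rintro ⟨h1, h2⟩ ⟨h3, -⟩
    obtain ⟨N, a, b, Φ, c, d⟩ := D
    obtain ⟨M, a', b', Ψ, c', d'⟩ := E
    obtain rfl : N = M := le_antisymm h1 h3
    obtain rfl : Φ = Ψ := MonoidHom.ext fun r => (h2 r).symm
    rfl

variable (D : QuotientDatum k Γ H)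

/-- `Φ(r) ∈ k^H`, for an element `r` of `Γ` that lies in `N`. -/
def phi (r : Γ) (hr : r ∈ D.N) : FunAlg k H := (D.Φ ⟨r, hr⟩ : FunAlg k H)

/-- The endomorphism of `Γ/N` induced by an element of `H`. -/
def quotMap (h : H) : Γ ⧸ D.N →* Γ ⧸ D.N :=
  QuotientGroup.map D.N D.N (MulDistribMulAction.toMonoidHom Γ h) (D.stable h)

theorem quotMap_mk (h : H) (r : Γ) : D.quotMap h (r : Γ ⧸ D.N) = ((h • r : Γ) : Γ ⧸ D.N) := rfl

/-- The induced action of `H` on `Γ/N`, given by `h.u(r) = u(h.r)`. -/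
def quotAct : H →* MulAut (Γ ⧸ D.N) where
  toFun h :=
    { toFun := D.quotMap h
      invFun := D.quotMap h⁻¹
      left_inv := by rintro ⟨r⟩; exact congrArg _ (inv_smul_smul h r)
      right_inv := by rintro ⟨r⟩; exact congrArg _ (smul_inv_smul h r)
      map_mul' := map_mul _ }
  map_one' := by ext ⟨r⟩; exact congrArg _ (one_smul H r)
  map_mul' h l := by ext ⟨r⟩; exact congrArg _ (mul_smul h l r)

@[simp] theorem quotAct_mk (h : H) (r : Γ) :
    D.quotAct h (r : Γ ⧸ D.N) = ((h • r : Γ) : Γ ⧸ D.N) := rfl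

/-- A section `j` of the canonical projection `u : Γ → Γ/N`, with `j(u(1)) = 1`. -/
structure Sec where
  toFun : Γ ⧸ D.N → Γ
  mk_toFun : ∀ x : Γ ⧸ D.N, (toFun x : Γ ⧸ D.N) = x
  map_one : toFun 1 = 1

variable {D}

instance : CoeFun D.Sec (fun _ => Γ ⧸ D.N → Γ) := ⟨Sec.toFun⟩

@[simp] theorem Sec.mk_apply (j : D.Sec) (x : Γ ⧸ D.N) : ((j x : Γ) : Γ ⧸ D.N) = x := j.mk_toFun x

theorem Sec.mem (j : D.Sec) (r : Γ) : r * (j (r : Γ ⧸ D.N))⁻¹ ∈ D.N := by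
  rw [← QuotientGroup.eq_one_iff]; simp

theorem Sec.mem_mul (j : D.Sec) (x y : Γ ⧸ D.N) : j x * j y * (j (x * y))⁻¹ ∈ D.N := by
  rw [← QuotientGroup.eq_one_iff]; simp

theorem Sec.mem_act (j : D.Sec) (l : H) (x : Γ ⧸ D.N) :
    (l • j x) * (j (D.quotAct l x))⁻¹ ∈ D.N := by
  rw [← QuotientGroup.eq_one_iff]; simp [← quotAct_mk]

theorem Sec.mem_inv (j : D.Sec) (h : H) (x : Γ ⧸ D.N) :
    (j (D.quotAct h⁻¹ x⁻¹))⁻¹ * h⁻¹ • (j x)⁻¹ ∈ D.N := by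
  rw [← QuotientGroup.eq_one_iff]
  simp only [QuotientGroup.mk_mul, QuotientGroup.mk_inv, ← quotAct_mk, Sec.mk_apply]
  simp

theorem phi_ne_zero (r : Γ) (hr : r ∈ D.N) (h : H) : D.phi r hr h ≠ 0 := by
  intro h0
  have h1 : D.phi r hr * ((D.Φ ⟨r, hr⟩)⁻¹ : (FunAlg k H)ˣ) = 1 := Units.mul_inv _
  have h2 := congrArg (fun f : FunAlg k H => f h) h1
  simp [h0] at h2

theorem phi_congr {r s : Γ} (hrs : r = s) (hr : r ∈ D.N) :
    D.phi r hr = D.phi s (hrs ▸ hr) := by subst hrs; rfl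

theorem phi_one (h1 : (1 : Γ) ∈ D.N) : D.phi 1 h1 = 1 := by
  have : D.Φ ⟨1, h1⟩ = 1 := map_one D.Φ
  simp [phi, this]

theorem phi_mul {r s : Γ} (hr : r ∈ D.N) (hs : s ∈ D.N) :
    D.phi r hr * D.phi s hs = D.phi (r * s) (mul_mem hr hs) := by
  have : D.Φ ⟨r * s, mul_mem hr hs⟩ = D.Φ ⟨r, hr⟩ * D.Φ ⟨s, hs⟩ := map_mul D.Φ ⟨r, hr⟩ ⟨s, hs⟩
  simp [phi, this]

theorem phi_conj (s : Γ) {r : Γ} (hr : r ∈ D.N) :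
    D.phi r hr = D.phi (s * r * s⁻¹) (D.normal.conj_mem r hr s) := by
  simp only [phi, D.Φ_conj ⟨r, hr⟩ s]

theorem phi_twist {r : Γ} (hr : r ∈ D.N) (l h : H) :
    D.phi r hr (l * h) = D.phi (l⁻¹ • r) (D.stable l⁻¹ r hr) h * D.phi r hr l :=
  D.Φ_mul ⟨r, hr⟩ l h

theorem phi_at_one {r : Γ} (hr : r ∈ D.N) : D.phi r hr 1 = 1 := by
  have h := phi_twist hr 1 1
  rw [mul_one] at h
  have h2 := phi_ne_zero r hr (1 : H)
  have h3 : D.phi ((1 : H)⁻¹ • r) (D.stable 1⁻¹ r hr) = D.phi r hr := phi_congr (by simp) _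
  rw [h3] at h
  exact (mul_eq_left₀ h2).1 h.symm

/-- The function `g(r) = Φ(r j(u(r))⁻¹)`. -/
def gauge (j : D.Sec) (r : Γ) : FunAlg k H := D.phi (r * (j (r : Γ ⧸ D.N))⁻¹) (j.mem r)

theorem gauge_ne_zero (j : D.Sec) (r : Γ) (h : H) : gauge j r h ≠ 0 := phi_ne_zero _ _ _

theorem gauge_at_one (j : D.Sec) (r : Γ) : gauge j r 1 = 1 := phi_at_one _

theorem gauge_one (j : D.Sec) (h : H) : gauge j 1 h = 1 := by
  have h1 : (1 : Γ) * (j ((1 : Γ) : Γ ⧸ D.N))⁻¹ = 1 := by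
    rw [QuotientGroup.mk_one, j.map_one]; simp
  rw [gauge, phi_congr h1, phi_one, FunAlg.one_apply]

theorem gauge_σ (j : D.Sec) (r s : Γ) (h : H) :
    gauge j r h * gauge j s h * D.phi _ (j.mem_mul (r : Γ ⧸ D.N) (s : Γ ⧸ D.N)) h =
      gauge j (r * s) h := by
  have h1 : gauge j r * gauge j s * D.phi _ (j.mem_mul (r : Γ ⧸ D.N) (s : Γ ⧸ D.N)) =
      gauge j (r * s) := by
    rw [gauge, gauge, phi_conj (j (r : Γ ⧸ D.N)) (j.mem s), phi_mul, phi_mul, gauge]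
    refine phi_congr ?_ _
    simp only [QuotientGroup.mk_mul]
    group
  rw [← h1]; rfl

theorem gauge_τ (j : D.Sec) (l : H) (r : Γ) (h : H) :
    gauge j r l⁻¹ * gauge j (l • r) (l * h) =
      gauge j r h * D.phi _ (j.mem_act l (r : Γ ⧸ D.N)) (l * h) := by
  have h1 : gauge j (l • r) = D.phi _ (D.stable l _ (j.mem r)) *
      D.phi _ (j.mem_act l (r : Γ ⧸ D.N)) := by
    rw [phi_mul, gauge]
    refine phi_congr ?_ _
    simp only [smul_mul', smul_inv', quotAct_mk]
    group
  have h2 := phi_twist (j.mem r) l⁻¹ (l * h)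
  simp only [inv_mul_cancel_left, inv_inv] at h2
  rw [h1, FunAlg.mul_apply]
  change _ = D.phi _ (j.mem r) h * _
  rw [h2]
  change D.phi _ (j.mem r) l⁻¹ * _ = _
  ring

theorem gauge_ω (j : D.Sec) (r : Γ) (h : H) :
    gauge j (h⁻¹ • r⁻¹) h⁻¹ = gauge j r h * D.phi _ (j.mem_inv h (r : Γ ⧸ D.N)) h⁻¹ := by
  have hc := inv_mem (j.mem r)
  have hc' : r⁻¹ * j (r : Γ ⧸ D.N) ∈ D.N := by
    rw [← QuotientGroup.eq_one_iff]; simp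
  have h0 : D.phi _ hc' = D.phi _ hc := by
    rw [phi_conj r hc']
    exact phi_congr (by group) _
  have h1 : gauge j (h⁻¹ • r⁻¹) = D.phi _ (D.stable h⁻¹ _ hc) *
      D.phi _ (j.mem_inv h (r : Γ ⧸ D.N)) := by
    rw [phi_conj (j (D.quotAct h⁻¹ (r : Γ ⧸ D.N)⁻¹)) (j.mem_inv h (r : Γ ⧸ D.N)),
      phi_conj (h⁻¹ • (r⁻¹ : Γ)) (D.stable h⁻¹ _ hc), phi_mul, gauge]
    refine phi_congr ?_ _
    have he : ((h⁻¹ • r⁻¹ : Γ) : Γ ⧸ D.N) = D.quotAct h⁻¹ (r : Γ ⧸ D.N)⁻¹ := rfl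
    rw [he]
    simp only [mul_inv_rev, inv_inv, smul_mul', smul_inv']
    group
  have h2 := phi_twist hc h h⁻¹
  rw [mul_inv_cancel, phi_at_one] at h2
  have h3 : gauge j r h * D.phi _ hc h = 1 := by
    have h4 : gauge j r * D.phi _ hc = 1 := by
      rw [gauge, phi_mul]
      exact (phi_congr (mul_inv_cancel _) _).trans (phi_one (one_mem _))
    rw [← FunAlg.mul_apply, h4]; rfl
  have h5 : D.phi _ (D.stable h⁻¹ _ hc) h⁻¹ = gauge j r h := by
    rw [← mul_right_inj' (phi_ne_zero _ hc h), mul_comm, ← h2, mul_comm, h3]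
  rw [h1, FunAlg.mul_apply, h5]

/-- `σ(x,y) = Φ(j(x) j(y) j(xy)⁻¹)` -/
def sig (j : D.Sec) (x y : Γ ⧸ D.N) : FunAlg k H :=
  D.phi (j x * j y * (j (x * y))⁻¹) (j.mem_mul x y)

/-- `τ_l(x) = Φ(l.j(x) j(l.x)⁻¹)` -/
def tau (j : D.Sec) (l : H) (x : Γ ⧸ D.N) : FunAlg k H :=
  D.phi ((l • j x) * (j (D.quotAct l x))⁻¹) (j.mem_act l x)

/-- `ω(x)(h) = Φ(j(h⁻¹.x⁻¹)⁻¹ h⁻¹.j(x)⁻¹)(h⁻¹)` -/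
def om (j : D.Sec) (x : Γ ⧸ D.N) (h : H) : k :=
  D.phi ((j (D.quotAct h⁻¹ x⁻¹))⁻¹ * h⁻¹ • (j x)⁻¹) (j.mem_inv h x) h⁻¹

theorem sig_mk (j : D.Sec) (r s : Γ) (h : H) : sig j (r : Γ ⧸ D.N) (s : Γ ⧸ D.N) h =
    gauge j (r * s) h / (gauge j r h * gauge j s h) := by
  rw [eq_div_iff (mul_ne_zero (gauge_ne_zero _ _ _) (gauge_ne_zero _ _ _)), mul_comm]
  exact gauge_σ j r s h

theorem tau_mk (j : D.Sec) (l : H) (r : Γ) (h : H) : tau j l (r : Γ ⧸ D.N) h =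
    gauge j r l⁻¹ * gauge j (l • r) h / gauge j r (l⁻¹ * h) := by
  rw [eq_div_iff (gauge_ne_zero _ _ _), mul_comm]
  have h1 := gauge_τ j l r (l⁻¹ * h)
  rw [mul_inv_cancel_left] at h1
  exact h1.symm

theorem om_mk (j : D.Sec) (r : Γ) (h : H) : om j (r : Γ ⧸ D.N) h =
    gauge j (h⁻¹ • r⁻¹) h⁻¹ / gauge j r h := by
  rw [eq_div_iff (gauge_ne_zero _ _ _), mul_comm]
  exact (gauge_ω j r h).symm

/-- The crossed datum of a quotient datum and a section. -/
def crossed (D : QuotientDatum k Γ H) (j : D.Sec) : CrossedDatum k (Γ ⧸ D.N) H where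
  act := D.quotAct
  σ x y := sig j x y
  τ l x := tau j l x
  ω x := om j x
  σ_assoc x y z h := by
    induction x using QuotientGroup.induction_on with | H r => ?_
    induction y using QuotientGroup.induction_on with | H s => ?_
    induction z using QuotientGroup.induction_on with | H t => ?_
    rw [← QuotientGroup.mk_mul, ← QuotientGroup.mk_mul]
    simp only [sig_mk, mul_assoc]
    have := gauge_ne_zero j (r * s) h
    have := gauge_ne_zero j (s * t) h
    field_simp
  σ_one_left x h := by
    induction x using QuotientGroup.induction_on with | H r => ?_
    rw [← QuotientGroup.mk_one, sig_mk, gauge_one, one_mul, one_mul, div_self (gauge_ne_zero _ _ _)]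
  σ_one_right x h := by
    induction x using QuotientGroup.induction_on with | H r => ?_
    rw [← QuotientGroup.mk_one, sig_mk, gauge_one, mul_one, mul_one, div_self (gauge_ne_zero _ _ _)]
  σ_counit x y := phi_at_one _
  τ_one x h := by
    induction x using QuotientGroup.induction_on with | H r => ?_
    rw [tau_mk, inv_one, one_smul, gauge_at_one, one_mul, one_mul, div_self (gauge_ne_zero _ _ _)]
  τ_counit l x := phi_at_one _
  τ_unit l h := by
    rw [← QuotientGroup.mk_one, tau_mk, smul_one]
    simp only [gauge_one]
    norm_num
  τ_coassoc m n x h := by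
    induction x using QuotientGroup.induction_on with | H r => ?_
    rw [quotAct_mk]
    simp only [tau_mk, mul_inv_rev, inv_mul_cancel_left, mul_smul, mul_assoc]
    have := gauge_ne_zero j r (m⁻¹ * n⁻¹)
    have := gauge_ne_zero j r h
    have := gauge_ne_zero j (m • r) (m * h)
    field_simp
  σ_τ l x y h := by
    induction x using QuotientGroup.induction_on with | H r => ?_
    induction y using QuotientGroup.induction_on with | H s => ?_
    rw [← QuotientGroup.mk_mul, quotAct_mk, quotAct_mk]
    simp only [sig_mk, tau_mk, inv_mul_cancel_left, smul_mul']
    have := gauge_ne_zero j r h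
    have := gauge_ne_zero j s h
    have := gauge_ne_zero j r l⁻¹
    have := gauge_ne_zero j s l⁻¹
    have := gauge_ne_zero j (r * s) h
    have := gauge_ne_zero j (l • r) (l * h)
    have := gauge_ne_zero j (l • s) (l * h)
    field_simp
  ω_left l x := by
    induction x using QuotientGroup.induction_on with | H r => ?_
    rw [← QuotientGroup.mk_inv, quotAct_mk, quotAct_mk]
    simp only [sig_mk, tau_mk, om_mk, inv_inv, inv_mul_cancel, ← smul_mul', smul_one, gauge_one,
      gauge_at_one]
    have := gauge_ne_zero j r l⁻¹
    have := gauge_ne_zero j (l • r) l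
    have := gauge_ne_zero j (l • r⁻¹) l
    field_simp
  ω_right l x := by
    induction x using QuotientGroup.induction_on with | H r => ?_
    rw [← QuotientGroup.mk_inv, quotAct_mk]
    simp only [sig_mk, tau_mk, om_mk, inv_mul_cancel, mul_inv_cancel, ← smul_inv', inv_smul_smul,
      gauge_one, gauge_at_one]
    have := gauge_ne_zero j r l⁻¹
    have := gauge_ne_zero j (l • r) l
    have := gauge_ne_zero j r⁻¹ l⁻¹
    field_simp

/-- The Hopf algebra `k[Γ/N] ⋊_Φ k^H` formed with the section `j`. Its structure maps are made
explicit in the lemmas below. -/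
abbrev QuotientHopf (D : QuotientDatum k Γ H) (j : D.Sec) : Type _ := (D.crossed j).Alg

namespace QuotientHopf

/-- The basis element `x # δ_h` of `k[Γ/N] ⋊_Φ k^H`. -/
abbrev basis (j : D.Sec) (x : Γ ⧸ D.N) (h : H) : D.QuotientHopf j := (D.crossed j).basis x h

variable [Fintype H]

/-- The element `x # f` of `k[Γ/N] ⋊_Φ k^H`. -/
abbrev tmul (j : D.Sec) (x : Γ ⧸ D.N) (f : FunAlg k H) : D.QuotientHopf j :=
  (D.crossed j).tmul x f

theorem one_eq (j : D.Sec) : (1 : D.QuotientHopf j) = tmul j 1 1 := rfl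

variable [DecidableEq H]

theorem tmul_delta (j : D.Sec) (x : Γ ⧸ D.N) (h : H) (f : FunAlg k H) :
    tmul j x (FunAlg.delta k h * f) = f h • basis j x h := by
  simp [tmul, CrossedDatum.tmul]

theorem basis_mul_basis (j : D.Sec) (x y : Γ ⧸ D.N) (h l : H) :
    basis j x h * basis j y l = tmul j (x * y)
      (FunAlg.delta k h * FunAlg.delta k l * D.phi (j x * j y * (j (x * y))⁻¹) (j.mem_mul x y)) := by
  rw [CrossedDatum.basis_mul, FunAlg.delta_mul]
  split_ifs
  · rw [tmul_delta]; rfl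
  · simp [tmul, CrossedDatum.tmul]

theorem comul_basis (j : D.Sec) (x : Γ ⧸ D.N) (h : H) :
    CoalgebraStruct.comul (R := k) (basis j x h) = ∑ l : H, basis j x l⁻¹ ⊗ₜ[k]
      tmul j (D.quotAct l x) (FunAlg.delta k (l * h) *
        D.phi ((l • j x) * (j (D.quotAct l x))⁻¹) (j.mem_act l x)) := by
  simp only [tmul_delta]
  exact CrossedDatum.comul_basis _ _ _

theorem counit_basis (j : D.Sec) (x : Γ ⧸ D.N) (h : H) :
    CoalgebraStruct.counit (R := k) (basis j x h) = if h = 1 then 1 else 0 :=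
  CrossedDatum.counit_basis _ _ _

theorem antipode_basis (j : D.Sec) (x : Γ ⧸ D.N) (h : H) :
    HopfAlgebraStruct.antipode k (basis j x h) = tmul j (D.quotAct h⁻¹ x⁻¹)
      (FunAlg.delta k h⁻¹ *
        D.phi ((j (D.quotAct h⁻¹ x⁻¹))⁻¹ * h⁻¹ • (j x)⁻¹) (j.mem_inv h x)) := by
  rw [tmul_delta]
  exact CrossedDatum.antipode_basis _ _ _

end QuotientHopf

end QuotientDatum

section HopfImage

variable {k A R : Type*} [Field k] [Ring A] [HopfAlgebra k A] [Ring R] [Algebra k R]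

/-- `(L, q, φ)` is a factorization of the algebra map `ρ : A → R`: `q : A → L` is a surjective
map of Hopf algebras, `φ : L → R` is an algebra map, and `ρ = φ ∘ q`. (A bialgebra map between
Hopf algebras automatically commutes with the antipodes.) -/
def IsFactorization (ρ : A →ₐ[k] R) {L : Type*} [Ring L] [HopfAlgebra k L]
    (q : A →ₐc[k] L) (φ : L →ₐ[k] R) : Prop :=
  Function.Surjective q ∧ φ.comp (q : A →ₐ[k] L) = ρ

/-- `(B, p, ψ)` is the Hopf image of `ρ`: it is a final object in the category of factorizations
of `ρ` (tested against Hopf algebras in the universe `w`). -/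
def IsHopfImage (ρ : A →ₐ[k] R) {B : Type*} [Ring B] [HopfAlgebra k B]
    (p : A →ₐc[k] B) (ψ : B →ₐ[k] R) : Prop :=
  IsFactorization ρ p ψ ∧
    ∀ (L : Type w) [Ring L] [HopfAlgebra k L] (q : A →ₐc[k] L) (φ : L →ₐ[k] R),
      IsFactorization ρ q φ →
        ∃! f : L →ₐc[k] B, f.comp q = p ∧ ψ.comp (f : L →ₐ[k] B) = φ

end HopfImage

/-- `ρ` is inner faithful: `(A, id, ρ)` is the Hopf image of `ρ`. Every factorization of `ρ` is
isomorphic to one by a Hopf algebra in the universe of `A`. -/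
def IsInnerFaithful.{a, u, v} {k : Type u} {A : Type a} {R : Type v} [Field k] [Ring A]
    [HopfAlgebra k A] [Ring R] [Algebra k R] (ρ : A →ₐ[k] R) : Prop :=
  IsHopfImage.{a} ρ (BialgHom.id k A) ρ

/-- The set `E(ρ)` of the quotient data `(N, Φ)` with `ρ(r # 1) = ρ(1 # Φ(r))` for all `r ∈ N`. -/
def compatibleData {k Γ H R : Type*} [Field k] [Group Γ] [Group H] [Fintype H] [DecidableEq H]
    [MulDistribMulAction H Γ] [Ring R] [Algebra k R] (ρ : SmashCoproduct k Γ H →ₐ[k] R) :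
    Set (QuotientDatum k Γ H) :=
  {D | ∀ (r : Γ) (hr : r ∈ D.N),
    ρ (SmashCoproduct.tmul r 1) = ρ (SmashCoproduct.tmul 1 (D.phi r hr))}

end

/-! Part 1 is a change of basis. The scalars σ, τ, ω of `QuotientHopf` are coboundaries of g(r) =
Φ(r ju(r)⁻¹), so r # δ_h ↦ g(r)(h) u(r) # δ_h is a Hopf algebra map (`proj`), and ρ factors through
it as soon as (N, Φ) lies in E(ρ) (`factorLin_proj`).

The core is a description of an arbitrary factorization (L, q, φ). Inner faithfulness on k^H makes q
injective there (`injective_comp_inclBialg`). The r with q(r # 1) = q(1 # f) for some unit f of k^H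
then form a quotient datum, with Φ(r) = f (`datumOfMap`), and q has the same kernel as the
projection attached to this datum. The latter holds because the q(r # δ_h), with r running over
representatives of Γ/N, are linearly independent (`linearIndependent_map_basis`). For h = 1 they are
group-like for the component of the coproduct cut out by δ_1 ⊗ δ_1; other components reduce general
h to h = 1.

No Zorn argument is needed. The sum I of all Hopf ideals inside ker ρ is a Hopf ideal, and the datum
of the quotient map by I is the greatest element of E(ρ) (`exists_isGreatest_compatibleData`). Hence
a maximal datum is the greatest one. It extends the datum of every factorization q, so its
projection kills ker q and descends along q (`proj_eq_zero_of_map_eq_zero`). -/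

noncomputable section

/-! ### Bialgebra maps between Hopf algebras: antipodes, kernels, descent. -/

section HopfGeneral

variable {k A B C : Type*} [Field k] [Ring A] [HopfAlgebra k A] [Ring B] [HopfAlgebra k B]
  [Ring C] [HopfAlgebra k C]

open WithConv in
/-- A bialgebra map between Hopf algebras commutes with the antipodes. -/
theorem BialgHom.map_antipode (f : A →ₐc[k] B) (a : A) :
    f (HopfAlgebraStruct.antipode k a) = HopfAlgebraStruct.antipode k (f a) := by
  -- In the convolution algebra Hom(A, B), f ∘ S is a left inverse of f and S ∘ f a right inverse,
  -- so the two agree.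
  have h1 : toConv (f.toLinearMap ∘ₗ HopfAlgebraStruct.antipode k) * toConv f.toLinearMap =
      (1 : WithConv (A →ₗ[k] B)) := by
    apply ofConv_injective
    calc _ = (AlgHomClass.toAlgHom f).toLinearMap ∘ₗ
            (toConv (HopfAlgebraStruct.antipode k) * toConv .id : WithConv (A →ₗ[k] A)).ofConv := by
          rw [LinearMap.algHom_comp_convMul_distrib]; rfl
      _ = _ := by rw [LinearMap.antipode_mul_id, LinearMap.algHom_comp_convOne]
  have h2 : toConv f.toLinearMap * toConv (HopfAlgebraStruct.antipode k ∘ₗ f.toLinearMap) =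
      (1 : WithConv (A →ₗ[k] B)) := by
    apply ofConv_injective
    calc _ = (toConv .id * toConv (HopfAlgebraStruct.antipode k) :
            WithConv (B →ₗ[k] B)).ofConv ∘ₗ f.toCoalgHom.toLinearMap := by
          rw [LinearMap.convMul_comp_coalgHom_distrib]; rfl
      _ = _ := by
        rw [LinearMap.id_mul_antipode]
        exact LinearMap.convOne_comp_coalgHom f.toCoalgHom
  have h3 := left_inv_eq_right_inv h1 h2
  exact LinearMap.congr_fun (congrArg ofConv h3) a

/-- The kernel of a bialgebra map between Hopf algebras is a Hopf ideal. -/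
theorem BialgHom.ker_isHopfIdeal (f : A →ₐc[k] B) :
    (RingHom.ker f).IsHopfIdeal k where
  counit_eq_zero x hx := by
    have hx : f x = 0 := hx
    rw [← CoalgHomClass.counit_comp_apply f, hx, map_zero]
  map_mkQ_comul_eq_zero x hx := by
    have hx : f x = 0 := hx
    set I : Submodule k A := (RingHom.ker f).restrictScalars k
    have hI : I = LinearMap.ker (f : A →ₗ[k] B) := rfl
    -- Over a field the tensor square of the injection A/ker f → B is injective, so the vanishing
    -- can be tested in B ⊗ B.
    let g : A ⧸ I →ₗ[k] B := I.liftQ (f : A →ₗ[k] B) hI.le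
    have hg : Function.Injective g := LinearMap.ker_eq_bot.1 (Submodule.ker_liftQ_eq_bot' _ _ hI)
    have hgg : Function.Injective (TensorProduct.map g g) :=
      TensorProduct.map_injective_of_flat_flat _ _ hg hg
    apply hgg
    rw [map_zero, ← LinearMap.comp_apply, ← TensorProduct.map_comp]
    have : g ∘ₗ I.mkQ = (f : A →ₗ[k] B) := I.liftQ_mkQ _ _
    rw [this]
    have h := CoalgHomClass.map_comp_comul_apply f x
    rw [hx, map_zero] at h
    exact h
  antipode_mem x hx := by
    have hx : f x = 0 := hx
    change f _ = 0
    rw [f.map_antipode, hx, map_zero]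

/-- A bialgebra map descends along a surjective bialgebra map whose kernel it kills. -/
theorem BialgHom.exists_comp_eq_of_ker_le (q : A →ₐc[k] B) (hq : Function.Surjective q)
    (p : A →ₐc[k] C) (h : ∀ a, q a = 0 → p a = 0) : ∃ f : B →ₐc[k] C, f.comp q = p := by
  -- p is constant on the fibres of q, so any set-theoretic preimage computes the descended map.
  have hs : ∀ a, p (Function.surjInv hq (q a)) = p a := fun a => by
    rw [← sub_eq_zero, ← map_sub]
    exact h _ (by rw [map_sub, Function.surjInv_eq hq, sub_self])
  let g : B →ₐ[k] C :=
    { toFun := fun b => p (Function.surjInv hq b)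
      map_one' := by rw [← map_one q, hs, map_one]
      map_zero' := by rw [← map_zero q, hs, map_zero]
      map_mul' := fun x y => by
        obtain ⟨a, rfl⟩ := hq x
        obtain ⟨b, rfl⟩ := hq y
        rw [← map_mul, hs, hs, hs, map_mul]
      map_add' := fun x y => by
        obtain ⟨a, rfl⟩ := hq x
        obtain ⟨b, rfl⟩ := hq y
        rw [← map_add, hs, hs, hs, map_add]
      commutes' := fun c => by rw [← AlgHomClass.commutes q c, hs, AlgHomClass.commutes] }
  have hg : ∀ a, g (q a) = p a := hs
  have hgq : g.toLinearMap ∘ₗ (q : A →ₗ[k] B) = (p : A →ₗ[k] C) := LinearMap.ext hg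
  refine ⟨BialgHom.ofAlgHom g ?_ ?_, BialgHom.ext hg⟩
  · apply AlgHom.ext
    intro b
    obtain ⟨a, rfl⟩ := hq b
    change CoalgebraStruct.counit (R := k) (g (q a)) = CoalgebraStruct.counit (R := k) (q a)
    rw [hg, CoalgHomClass.counit_comp_apply, CoalgHomClass.counit_comp_apply]
  · apply AlgHom.ext
    intro b
    obtain ⟨a, rfl⟩ := hq b
    change TensorProduct.map g.toLinearMap g.toLinearMap (CoalgebraStruct.comul (R := k) (q a)) =
      CoalgebraStruct.comul (R := k) (g (q a))
    rw [hg, ← CoalgHomClass.map_comp_comul_apply, ← CoalgHomClass.map_comp_comul_apply,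
      ← LinearMap.comp_apply, ← TensorProduct.map_comp, hgq]

end HopfGeneral

/-! ### Sums of Hopf ideals. -/

section SupHopf

variable {k A : Type*} [Field k] [Ring A] [HopfAlgebra k A]

/-- The supremum is a sum, so additive conditions pass to it. Each axiom of a two-sided Hopf ideal
is checked this way. -/
theorem Ideal.sSup_induction_mem {S : Set (Ideal A)} {P : A → Prop}
    (hmem : ∀ J ∈ S, ∀ a ∈ J, P a) (h0 : P 0) (hadd : ∀ a b, P a → P b → P (a + b))
    {a : A} (ha : a ∈ sSup S) : P a := by
  rw [sSup_eq_iSup'] at ha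
  exact Submodule.iSup_induction _ (motive := P) ha (fun J a ha => hmem J J.2 a ha) h0 hadd

theorem Ideal.isTwoSided_sSup {S : Set (Ideal A)} (hS : ∀ J ∈ S, J.IsTwoSided) :
    (sSup S).IsTwoSided where
  mul_mem_of_left {a} b ha := by
    refine Ideal.sSup_induction_mem (P := fun a => a * b ∈ sSup S) ?_ ?_ ?_ ha
    · intro J hJ a ha
      have := hS J hJ
      exact le_sSup hJ (J.mul_mem_right b ha)
    · simp
    · intro a c ha hc
      rw [add_mul]
      exact add_mem ha hc

theorem Ideal.isHopfIdeal_sSup {S : Set (Ideal A)} (hS : ∀ J ∈ S, J.IsHopfIdeal k) :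
    (sSup S).IsHopfIdeal k where
  counit_eq_zero x hx := by
    refine Ideal.sSup_induction_mem (P := fun a => CoalgebraStruct.counit (R := k) a = 0) ?_ ?_ ?_
      (Submodule.restrictScalars_mem k _ _ |>.1 hx)
    · intro J hJ a ha
      exact (hS J hJ).counit_eq_zero ha
    · simp
    · intro a b ha hb
      rw [map_add, ha, hb, add_zero]
  map_mkQ_comul_eq_zero x hx := by
    set I : Submodule k A := (sSup S).restrictScalars k
    refine Ideal.sSup_induction_mem (P := fun a => TensorProduct.map I.mkQ I.mkQ
      (CoalgebraStruct.comul (R := k) a) = 0) ?_ ?_ ?_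
      (Submodule.restrictScalars_mem k _ _ |>.1 hx)
    · intro J hJ a ha
      have h1 := (hS J hJ).map_mkQ_comul_eq_zero ha
      have hJI : J.restrictScalars k ≤ I := fun y hy => le_sSup hJ hy
      -- A → A/I factors through A/J, so vanishing modulo J gives vanishing modulo I.
      have h2 : I.mkQ = Submodule.factor hJI ∘ₗ (J.restrictScalars k).mkQ := by
        ext; rfl
      rw [h2, TensorProduct.map_comp, LinearMap.comp_apply, h1, map_zero]
    · simp
    · intro a b ha hb
      rw [map_add, map_add, ha, hb, add_zero]
  antipode_mem x hx := by
    refine Ideal.sSup_induction_mem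
      (P := fun a => HopfAlgebraStruct.antipode k a ∈ sSup S) ?_ ?_ ?_ hx
    · intro J hJ a ha
      exact le_sSup hJ ((hS J hJ).antipode_mem ha)
    · simp
    · intro a b ha hb
      rw [map_add]
      exact add_mem ha hb

end SupHopf

/-! ### Computations in the smash coproduct. -/

namespace SmashCoproduct

variable {k Γ H : Type*} [Field k] [Group Γ] [Group H] [Fintype H] [DecidableEq H]
  [MulDistribMulAction H Γ]

theorem basis_one_mul_basis {k Γ H : Type*} [Field k] [Group Γ] [Group H] [DecidableEq H]
    [MulDistribMulAction H Γ] (r : Γ) (h : H) :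
    basis k 1 h * basis k r h = basis k r h := by
  rw [basis_mul_basis, if_pos rfl, one_mul]

theorem tmul_mul_basis (r s : Γ) (f : FunAlg k H) (h : H) :
    tmul r f * basis k s h = f h • basis k (r * s) h := by
  simp [tmul, CrossedDatum.tmul, Finset.sum_mul, basis_mul_basis]

theorem tmul_one (r : Γ) : tmul r (1 : FunAlg k H) = ∑ h : H, basis k r h := by
  change ∑ h : H, (1 : FunAlg k H) h • basis k r h = _
  simp

theorem tmul_one_mul_tmul_one (r s : Γ) :
    tmul r (1 : FunAlg k H) * tmul s 1 = tmul (r * s) 1 := by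
  rw [tmul_one s, Finset.mul_sum, tmul_one (r * s)]
  exact Finset.sum_congr rfl fun h _ => by rw [tmul_mul_basis, FunAlg.one_apply, one_smul]

theorem incl_delta (h : H) : incl k Γ H (FunAlg.delta k h) = basis k 1 h := by
  change (smashDatum k Γ H).tmul 1 (FunAlg.delta k h) = _
  simp [CrossedDatum.tmul]

/-- Multiply by φ(1 # δ_h) in one direction and sum over h in the other. Relations r # 1 ~ 1 # f
thus become one scalar relation for each h. -/
theorem map_tmul_eq_iff {B : Type*} [Ring B] [Algebra k B] (φ : SmashCoproduct k Γ H →ₐ[k] B)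
    (r : Γ) (f : FunAlg k H) :
    φ (tmul r 1) = φ (tmul 1 f) ↔ ∀ h, φ (basis k r h) = f h • φ (basis k 1 h) := by
  constructor
  · intro hr h
    have h1 := congrArg (· * φ (basis k 1 h)) hr
    simpa only [← map_mul, tmul_mul_basis, mul_one, FunAlg.one_apply, one_smul, map_smul] using h1
  · intro hr
    rw [tmul_one, tmul, CrossedDatum.tmul, map_sum, map_sum]
    exact Finset.sum_congr rfl fun h _ => by rw [hr, map_smul]

/-- The embedding `k^H → k[Γ] ⋊ k^H` as a map of bialgebras. -/
def inclBialg (k Γ H : Type*) [Field k] [Group Γ] [Group H] [Fintype H] [DecidableEq H]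
    [MulDistribMulAction H Γ] : FunAlg k H →ₐc[k] SmashCoproduct k Γ H :=
  BialgHom.ofAlgHom (incl k Γ H)
    (AlgHom.toLinearMap_injective <| FunAlg.lin_ext fun h => by
      change CoalgebraStruct.counit (R := k) (incl k Γ H (FunAlg.delta k h)) =
        FunAlg.counitLin k H _
      rw [incl_delta, counit_basis, FunAlg.counitLin_delta])
    (AlgHom.toLinearMap_injective <| FunAlg.lin_ext fun h => by
      change TensorProduct.map (incl k Γ H).toLinearMap (incl k Γ H).toLinearMap
        (CoalgebraStruct.comul (R := k) (FunAlg.delta k h)) =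
        CoalgebraStruct.comul (R := k) (incl k Γ H (FunAlg.delta k h))
      rw [incl_delta, comul_basis, FunAlg.comul_delta, map_sum, ← Equiv.sum_comp (Equiv.inv H)]
      simp [incl_delta])

end SmashCoproduct

/-! ### The projection attached to a quotient datum and the factorization of ρ. -/

namespace QuotientDatum

variable {k Γ H : Type*} [Field k] [Group Γ] [Group H] [Fintype H] [DecidableEq H]
  [MulDistribMulAction H Γ]

instance (D : QuotientDatum k Γ H) : Nonempty D.Sec := by
  classical
  exact ⟨{
    toFun := fun x => if x = 1 then 1 else x.out
    mk_toFun := fun x => by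
      split_ifs with h
      · simp [h]
      · simp
    map_one := by simp }⟩

variable {D : QuotientDatum k Γ H}

theorem gauge_sec {k Γ H : Type*} [Field k] [Group Γ] [Group H] [MulDistribMulAction H Γ]
    {D : QuotientDatum k Γ H} (j : D.Sec) (x : Γ ⧸ D.N) (h : H) : gauge j (j x) h = 1 := by
  have h1 : j x * (j ((j x : Γ) : Γ ⧸ D.N))⁻¹ = 1 := by simp
  rw [gauge, phi_congr h1, phi_one, FunAlg.one_apply]

/-- The linear map `r # δ_h ↦ u(r) # δ_h Φ(r ju(r)⁻¹)`. -/
def projLin (j : D.Sec) : SmashCoproduct k Γ H →ₗ[k] D.QuotientHopf j :=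
  (smashDatum k Γ H).lift fun r h => gauge j r h • QuotientHopf.basis j (r : Γ ⧸ D.N) h

theorem projLin_basis (j : D.Sec) (r : Γ) (h : H) : projLin j (SmashCoproduct.basis k r h) =
    gauge j r h • QuotientHopf.basis j (r : Γ ⧸ D.N) h := CrossedDatum.lift_basis _ _ _ _

/-- The map `r # δ_h ↦ u(r) # δ_h Φ(r ju(r)⁻¹)` as an algebra map. -/
def projAlg (j : D.Sec) : SmashCoproduct k Γ H →ₐ[k] D.QuotientHopf j :=
  AlgHom.ofLinearMap (projLin j)
    (by
      rw [CrossedDatum.one_def, CrossedDatum.one_def, map_sum]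
      refine Finset.sum_congr rfl fun h _ => ?_
      rw [projLin_basis, gauge_one, one_smul]
      rfl)
    (by
      suffices hm : (LinearMap.mul k (SmashCoproduct k Γ H)).compr₂ (projLin j) =
          (LinearMap.mul k (D.QuotientHopf j)).compl₁₂ (projLin j) (projLin j) from
        fun a b => LinearMap.congr_fun (LinearMap.congr_fun hm a) b
      refine CrossedDatum.lin_ext fun r h => CrossedDatum.lin_ext fun s l => ?_
      simp only [LinearMap.compr₂_apply, LinearMap.mul_apply', LinearMap.compl₁₂_apply,
        projLin_basis, SmashCoproduct.basis_mul_basis, smul_mul_smul_comm]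
      rw [CrossedDatum.basis_mul]
      split_ifs with hl
      · subst hl
        -- Multiplicativity is exactly the statement that σ is the coboundary of the gauge;
        -- `gauge_τ` plays this role for the coproduct.
        rw [projLin_basis, smul_smul, ← gauge_σ]
        rfl
      · rw [map_zero, smul_zero])

theorem projAlg_basis (j : D.Sec) (r : Γ) (h : H) : projAlg j (SmashCoproduct.basis k r h) =
    gauge j r h • QuotientHopf.basis j (r : Γ ⧸ D.N) h := projLin_basis j r h

/-- The projection `k[Γ] ⋊ k^H → k[Γ/N] ⋊_Φ k^H`, `r # δ_h ↦ u(r) # δ_h Φ(r ju(r)⁻¹)`. -/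
def proj (j : D.Sec) : SmashCoproduct k Γ H →ₐc[k] D.QuotientHopf j :=
  BialgHom.ofAlgHom (projAlg j)
    (AlgHom.toLinearMap_injective <| CrossedDatum.lin_ext fun r h => by
      change CoalgebraStruct.counit (R := k) (projAlg j (SmashCoproduct.basis k r h)) =
        CoalgebraStruct.counit (R := k) (SmashCoproduct.basis k r h)
      rw [projAlg_basis, map_smul, QuotientHopf.counit_basis, SmashCoproduct.counit_basis]
      split_ifs with hh
      · rw [hh, gauge_at_one, one_smul]
      · rw [smul_zero])
    (AlgHom.toLinearMap_injective <| CrossedDatum.lin_ext fun r h => by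
      change TensorProduct.map (projAlg j).toLinearMap (projAlg j).toLinearMap
        (CoalgebraStruct.comul (R := k) (SmashCoproduct.basis k r h)) =
        CoalgebraStruct.comul (R := k) (projAlg j (SmashCoproduct.basis k r h))
      rw [SmashCoproduct.comul_basis, projAlg_basis, map_smul, CrossedDatum.comul_basis,
        map_sum, Finset.smul_sum]
      refine Finset.sum_congr rfl fun l _ => ?_
      rw [TensorProduct.map_tmul, AlgHom.toLinearMap_apply, AlgHom.toLinearMap_apply,
        projAlg_basis, projAlg_basis, TensorProduct.smul_tmul_smul, TensorProduct.tmul_smul,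
        smul_smul, gauge_τ]
      rfl)

theorem proj_basis (j : D.Sec) (r : Γ) (h : H) : proj j (SmashCoproduct.basis k r h) =
    gauge j r h • QuotientHopf.basis j (r : Γ ⧸ D.N) h := projLin_basis j r h

theorem proj_surjective (j : D.Sec) : Function.Surjective (proj j) := by
  have hr : LinearMap.range (proj j : SmashCoproduct k Γ H →ₗ[k] D.QuotientHopf j) = ⊤ := by
    have hb : ∀ x h, QuotientHopf.basis j x h ∈
        LinearMap.range (proj j : SmashCoproduct k Γ H →ₗ[k] D.QuotientHopf j) := fun x h =>
      ⟨SmashCoproduct.basis k (j x) h, by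
        change proj j _ = _
        rw [proj_basis, gauge_sec, one_smul, Sec.mk_apply]⟩
    -- The quotient map by the range vanishes on a basis, so it is zero.
    rw [← Submodule.ker_mkQ (LinearMap.range _), LinearMap.ker_eq_top]
    refine CrossedDatum.lin_ext fun x h => ?_
    exact (Submodule.Quotient.mk_eq_zero _).2 (hb x h)
  exact LinearMap.range_eq_top.1 hr

theorem gauge_eq_phi {k Γ H : Type*} [Field k] [Group Γ] [Group H] [MulDistribMulAction H Γ]
    {D : QuotientDatum k Γ H} (j : D.Sec) {r : Γ} (hr : r ∈ D.N) : gauge j r = D.phi r hr := by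
  refine phi_congr ?_ _
  rw [(QuotientGroup.eq_one_iff r).2 hr, j.map_one, inv_one, mul_one]

theorem proj_tmul (j : D.Sec) {r : Γ} (hr : r ∈ D.N) :
    proj j (SmashCoproduct.tmul r 1) = proj j (SmashCoproduct.tmul 1 (D.phi r hr)) := by
  refine (SmashCoproduct.map_tmul_eq_iff
    (proj j : SmashCoproduct k Γ H →ₐ[k] D.QuotientHopf j) r _).2 fun h => ?_
  change proj j _ = _ • proj j _
  rw [proj_basis, proj_basis, gauge_one, one_smul, (QuotientGroup.eq_one_iff r).2 hr,
    gauge_eq_phi j hr, QuotientGroup.mk_one]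

section Compatible

variable {R : Type*} [Ring R] [Algebra k R] {ρ : SmashCoproduct k Γ H →ₐ[k] R}

/-- The extra factor s allows the decomposition of t ∈ Γ as (t ju(t)⁻¹) · ju(t). -/
theorem map_basis_of_compatible (hD : D ∈ compatibleData ρ) {r : Γ} (hr : r ∈ D.N) (s : Γ)
    (h : H) : ρ (SmashCoproduct.basis k (r * s) h) =
      D.phi r hr h • ρ (SmashCoproduct.basis k s h) := by
  have h1 := (SmashCoproduct.map_tmul_eq_iff ρ r _).1 (hD r hr) h
  have h2 : SmashCoproduct.basis k (r * s) h =
      SmashCoproduct.basis k r h * SmashCoproduct.basis k s h := by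
    rw [SmashCoproduct.basis_mul_basis, if_pos rfl]
  rw [h2, map_mul, h1, smul_mul_assoc, ← map_mul, SmashCoproduct.basis_one_mul_basis]

/-- The linear map `x # δ_h ↦ ρ(j(x) # δ_h)`. -/
def factorLin (ρ : SmashCoproduct k Γ H →ₐ[k] R) (j : D.Sec) : D.QuotientHopf j →ₗ[k] R :=
  (D.crossed j).lift fun x h => ρ (SmashCoproduct.basis k (j x) h)

theorem factorLin_basis (j : D.Sec) (x : Γ ⧸ D.N) (h : H) :
    factorLin ρ j (QuotientHopf.basis j x h) = ρ (SmashCoproduct.basis k (j x) h) :=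
  CrossedDatum.lift_basis _ _ _ _

/-- Established before `factorLin` is known to be multiplicative: multiplicativity is then inherited
from ρ, since the projection is surjective. It is also applied below with Hopf algebra maps in place
of ρ. -/
theorem factorLin_proj (hD : D ∈ compatibleData ρ) (j : D.Sec) (a : SmashCoproduct k Γ H) :
    factorLin ρ j (proj j a) = ρ a := by
  suffices h : factorLin ρ j ∘ₗ (proj j : SmashCoproduct k Γ H →ₗ[k] D.QuotientHopf j) =
      ρ.toLinearMap from LinearMap.congr_fun h a
  refine CrossedDatum.lin_ext fun r h => ?_
  change factorLin ρ j (proj j (SmashCoproduct.basis k r h)) = ρ (SmashCoproduct.basis k r h)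
  rw [proj_basis, map_smul, factorLin_basis, gauge, ← map_basis_of_compatible hD (j.mem r)]
  simp

/-- The algebra map `x # δ_h ↦ ρ(j(x) # δ_h)` for a compatible quotient datum. -/
def factor (hD : D ∈ compatibleData ρ) (j : D.Sec) : D.QuotientHopf j →ₐ[k] R :=
  AlgHom.ofLinearMap (factorLin ρ j)
    (by rw [← map_one (proj j), factorLin_proj hD, map_one])
    (fun x y => by
      obtain ⟨a, rfl⟩ := proj_surjective j x
      obtain ⟨b, rfl⟩ := proj_surjective j y
      rw [← map_mul, factorLin_proj hD, factorLin_proj hD, factorLin_proj hD, map_mul])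

theorem isFactorization_proj (hD : D ∈ compatibleData ρ) (j : D.Sec) :
    IsFactorization ρ (proj j) (factor hD j) :=
  ⟨proj_surjective j, AlgHom.ext (factorLin_proj hD j)⟩

end Compatible

end QuotientDatum

/-! ### Linear independence of group-like elements. -/

open TensorProduct Submodule in
/-- The nonzero elements `v` with `Δ v = v ⊗ v`, for a linear map `Δ : V → V ⊗ V`, are linearly
independent. -/
theorem linearIndepOn_of_map_eq_tmul_self {k V : Type*} [Field k] [AddCommGroup V] [Module k V]
    (Δ : V →ₗ[k] V ⊗[k] V) : LinearIndepOn k id {v : V | v ≠ 0 ∧ Δ v = v ⊗ₜ[k] v} := by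
  classical
  rw [linearIndepOn_iff_linearIndepOn_finset]
  rintro s hs
  induction s using Finset.cons_induction with
  | empty => simp
  | cons a s has ih =>
  simp only [Finset.cons_eq_insert, Finset.coe_insert, Set.subset_def, Set.mem_insert_iff,
    Finset.mem_coe, Set.mem_ofPred_eq, forall_eq_or_imp] at hs
  obtain ⟨ha, hs⟩ := hs
  specialize ih hs
  rw [Finset.coe_cons]
  refine ih.id_insert ?_
  rw [mem_span_finset]
  rintro ⟨c, -, hc⟩
  replace ih := ih.tmul_of_isDomain ih
  simp_rw [← Finset.coe_product, linearIndepOn_finset_iffₛ, id] at ih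
  -- If a = ∑ c_x x, computing Δ a in two ways gives c_x c_y = 0 for x ≠ y and c_x² = c_x, because
  -- the x ⊗ y are independent. A nonzero c_x would force a = x ∈ s; otherwise a = 0. Neither
  -- coassociativity nor a counit is used.
  have key := calc
        ∑ x ∈ s, ∑ y ∈ s, (if x = y then c x else 0) • x ⊗ₜ[k] y
    _ = ∑ x ∈ s, c x • x ⊗ₜ[k] x := by simp
    _ = Δ a := by
      rw [← hc, map_sum]
      exact Finset.sum_congr rfl fun x hx => by rw [map_smul, (hs x hx).2]
    _ = a ⊗ₜ a := ha.2
    _ = ∑ x ∈ s, ∑ y ∈ s, (c x * c y) • x ⊗ₜ[k] y := by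
      conv_lhs => rw [← hc]
      simp_rw [sum_tmul, tmul_sum, ← smul_tmul', tmul_smul, smul_smul]
  simp_rw [← Finset.sum_product'] at key
  apply ih at key
  have hc0 : ∀ x ∈ s, c x = 0 := fun x hx => by
    by_contra hcx
    have hcy : ∀ y ∈ s, y ≠ x → c y = 0 := fun y hys hyx => by
      simpa [hcx, hyx] using (key (y, x) (by simp [hys, hx])).symm
    rw [Finset.sum_eq_single_of_mem x hx fun y hy hyx => by rw [hcy y hy hyx, zero_smul]] at hc
    have h1 : c x = 1 := by simpa [hcx] using (key (x, x) (by simp [hx])).symm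
    rw [h1, one_smul] at hc
    exact has (hc ▸ hx)
  exact ha.1 (by rw [← hc]; exact Finset.sum_eq_zero fun x hx => by rw [hc0 x hx, zero_smul])

/-! ### The quotient datum of a Hopf algebra map that is injective on k^H, and its kernel. -/

namespace SmashCoproduct

variable {k Γ H : Type*} [Field k] [Group Γ] [Group H] [Fintype H] [DecidableEq H]
  [MulDistribMulAction H Γ] {L : Type*} [Ring L] [HopfAlgebra k L]

/-- The δ's are orthogonal idempotents, so only the term l = a⁻¹ of the coproduct survives, and only
if lh = b. -/
theorem basis_tmul_basis_mul_comul (r : Γ) (a b h : H) :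
    (basis k 1 a ⊗ₜ[k] basis k 1 b) * CoalgebraStruct.comul (R := k) (basis k r h) =
      if h = a * b then basis k r a ⊗ₜ[k] basis k (a⁻¹ • r) b else 0 := by
  rw [comul_basis, Finset.mul_sum, Finset.sum_eq_single a⁻¹]
  · rw [Algebra.TensorProduct.tmul_mul_tmul, inv_inv, basis_one_mul_basis, basis_mul_basis, one_mul]
    by_cases hb : h = a * b
    · subst hb
      simp
    · rw [if_neg hb, if_neg, TensorProduct.tmul_zero]
      rintro rfl
      simp at hb
  · intro l _ hl
    rw [Algebra.TensorProduct.tmul_mul_tmul, basis_mul_basis, if_neg, TensorProduct.zero_tmul]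
    rintro rfl
    simp at hl
  · simp

/-- The component of the coproduct of `L` cut out by the images of `1 # δ_a` and `1 # δ_b`. -/
def comulComponent (q : SmashCoproduct k Γ H →ₐc[k] L) (a b : H) : L →ₗ[k] L ⊗[k] L :=
  LinearMap.mulLeft k (q (basis k 1 a) ⊗ₜ[k] q (basis k 1 b)) ∘ₗ CoalgebraStruct.comul

/-- For a = b = 1 this makes q(r # δ_1) group-like. The other components relate r to its translates
a⁻¹.r, which is how the action of H enters. -/
theorem comulComponent_basis (q : SmashCoproduct k Γ H →ₐc[k] L) (a b h : H) (r : Γ) :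
    comulComponent q a b (q (basis k r h)) =
      if h = a * b then q (basis k r a) ⊗ₜ[k] q (basis k (a⁻¹ • r) b) else 0 := by
  let qq := Algebra.TensorProduct.map (q : SmashCoproduct k Γ H →ₐ[k] L)
    (q : SmashCoproduct k Γ H →ₐ[k] L)
  have h1 := congrArg qq (basis_tmul_basis_mul_comul (k := k) r a b h)
  have h2 : qq (CoalgebraStruct.comul (R := k) (basis k r h)) =
      CoalgebraStruct.comul (R := k) (q (basis k r h)) :=
    CoalgHomClass.map_comp_comul_apply q _
  rw [map_mul, h2, apply_ite qq, map_zero] at h1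
  exact h1

theorem map_basis_one_ne_zero {q : SmashCoproduct k Γ H →ₐc[k] L}
    (hq : Function.Injective (q.comp (inclBialg k Γ H))) (h : H) : q (basis k 1 h) ≠ 0 := by
  intro h0
  have h1 : q.comp (inclBialg k Γ H) (FunAlg.delta k h) = 0 := by
    change q (incl k Γ H (FunAlg.delta k h)) = 0
    rw [incl_delta, h0]
  rw [map_eq_zero_iff _ hq] at h1
  have h2 := congrArg (fun f : FunAlg k H => f h) h1
  simp at h2

theorem map_basis_ne_zero {q : SmashCoproduct k Γ H →ₐc[k] L}
    (hq : Function.Injective (q.comp (inclBialg k Γ H))) (r : Γ) (h : H) :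
    q (basis k r h) ≠ 0 := by
  intro h0
  apply map_basis_one_ne_zero hq h
  have h1 : basis k 1 h = basis k r⁻¹ h * basis k r h := by
    rw [basis_mul_basis, if_pos rfl, inv_mul_cancel]
  rw [h1, map_mul, h0, mul_zero]

section DatumOfMap

variable (q : SmashCoproduct k Γ H →ₐc[k] L)

/-- The homomorphism `r ↦ q(r # 1)` to the units of `L`. -/
def groupUnits : Γ →* Lˣ :=
  MonoidHom.toHomUnits
    { toFun := fun r => q (tmul r 1)
      map_one' := map_one q
      map_mul' := fun r s => by rw [← map_mul, tmul_one_mul_tmul_one] }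

/-- The homomorphism `f ↦ q(1 # f)` from the units of `k^H` to those of `L`. -/
def functionUnits : (FunAlg k H)ˣ →* Lˣ :=
  Units.map (q.comp (inclBialg k Γ H) : FunAlg k H →* L)

/-- The subgroup of all `r` such that `q(r # 1)` comes from a unit of `k^H`. -/
def scalarSubgroup : Subgroup Γ := (functionUnits q).range.comap (groupUnits q)

variable {q} (hq : Function.Injective (q.comp (inclBialg k Γ H)))

/-- The homomorphism `Φ` with `q(r # 1) = q(1 # Φ(r))`. -/
def scalarHom : scalarSubgroup q →* (FunAlg k H)ˣ :=
  -- The units of k^H embed in those of L, so the preimage of q(r # 1) is unique and multiplicative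
  -- in r.
  (MonoidHom.ofInjective (f := functionUnits q) (Units.map_injective hq)).symm.toMonoidHom.comp
    ((groupUnits q).subgroupComap (functionUnits q).range)

theorem map_tmul_scalarHom (r : scalarSubgroup q) :
    q (tmul r 1) = q (tmul 1 (scalarHom hq r : FunAlg k H)) := by
  have h1 : functionUnits q (scalarHom hq r) = groupUnits q r :=
    congrArg Subtype.val ((MonoidHom.ofInjective (f := functionUnits q)
      (Units.map_injective hq)).apply_symm_apply _)
  exact (congrArg Units.val h1).symm

theorem map_basis_scalarHom (r : scalarSubgroup q) (h : H) :
    q (basis k r h) = (scalarHom hq r : FunAlg k H) h • q (basis k 1 h) :=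
  (map_tmul_eq_iff (q : SmashCoproduct k Γ H →ₐ[k] L) r _).1 (map_tmul_scalarHom hq r) h

theorem mem_scalarSubgroup_of_map_tmul_eq {r : Γ} {f : (FunAlg k H)ˣ}
    (h : q (tmul r 1) = q (tmul 1 (f : FunAlg k H))) : r ∈ scalarSubgroup q :=
  ⟨f, Units.ext h.symm⟩

/-- The scalars are automatically nonzero, since q(r # δ_h) ≠ 0, so together they form a unit of
k^H. -/
theorem mem_scalarSubgroup_of_map_basis
    (hq : Function.Injective (q.comp (inclBialg k Γ H))) {r : Γ}
    (hr : ∀ h, ∃ c : k, q (basis k r h) = c • q (basis k 1 h)) : r ∈ scalarSubgroup q := by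
  choose c hc using hr
  have hc0 : ∀ h, c h ≠ 0 := fun h h0 => map_basis_ne_zero hq r h (by rw [hc, h0, zero_smul])
  let f : (FunAlg k H)ˣ :=
    ⟨FunAlg.mk c, FunAlg.mk fun h => (c h)⁻¹, by ext h; simp [hc0], by ext h; simp [hc0]⟩
  exact mem_scalarSubgroup_of_map_tmul_eq (f := f)
    ((map_tmul_eq_iff (q : SmashCoproduct k Γ H →ₐ[k] L) r (f : FunAlg k H)).2 hc)

theorem scalarHom_eq_of_map_basis (r : scalarSubgroup q) {h : H} {c : k}
    (hr : q (basis k r h) = c • q (basis k 1 h)) : (scalarHom hq r : FunAlg k H) h = c := by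
  rw [map_basis_scalarHom hq] at hr
  exact smul_left_injective k (map_basis_one_ne_zero hq h) hr

theorem map_basis_conj (r : scalarSubgroup q) (s : Γ) (h : H) :
    q (basis k (s * r * s⁻¹) h) = (scalarHom hq r : FunAlg k H) h • q (basis k 1 h) := by
  have h1 : basis k (s * r * s⁻¹) h = basis k s h * basis k (r : Γ) h * basis k s⁻¹ h := by
    simp only [basis_mul_basis, if_true]
  rw [h1, map_mul, map_mul, map_basis_scalarHom hq, mul_smul_comm, smul_mul_assoc, ← map_mul,
    ← map_mul, basis_mul_basis, if_pos rfl, basis_mul_basis, if_pos rfl, mul_one, mul_inv_cancel]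

/-- Apply the (a, b) component of the coproduct to q(r # δ_{ab}) = Φ(r)(ab) q(1 # δ_{ab}). This
single identity yields both the H-stability of N and the twisted multiplicativity of Φ(r). -/
theorem smul_map_basis_smul (r : scalarSubgroup q) (a b : H) :
    (scalarHom hq r : FunAlg k H) a • q (basis k (a⁻¹ • (r : Γ)) b) =
      (scalarHom hq r : FunAlg k H) (a * b) • q (basis k 1 b) := by
  have h1 := comulComponent_basis q a b (a * b) r
  rw [map_basis_scalarHom hq, map_smul, comulComponent_basis, if_pos rfl, if_pos rfl,
    map_basis_scalarHom hq, show a⁻¹ • (1 : Γ) = 1 from smul_one _, ← TensorProduct.tmul_smul, ← TensorProduct.smul_tmul',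
    ← TensorProduct.tmul_smul] at h1
  -- A functional equal to 1 on the first factor strips it from the tensor.
  obtain ⟨f, hf⟩ := Module.Projective.exists_dual_eq_one k (map_basis_one_ne_zero hq a)
  have h2 := congrArg ((TensorProduct.lid k L).toLinearMap ∘ₗ TensorProduct.map f LinearMap.id) h1
  simpa [hf] using h2.symm

theorem scalarHom_ne_zero (r : scalarSubgroup q) (h : H) :
    (scalarHom hq r : FunAlg k H) h ≠ 0 := fun h0 =>
  map_basis_ne_zero hq r h (by rw [map_basis_scalarHom hq, h0, zero_smul])

theorem map_basis_inv_smul (r : scalarSubgroup q) (a b : H) :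
    q (basis k (a⁻¹ • (r : Γ)) b) = ((scalarHom hq r : FunAlg k H) (a * b) /
      (scalarHom hq r : FunAlg k H) a) • q (basis k 1 b) := by
  rw [div_eq_inv_mul, mul_smul, ← smul_map_basis_smul, inv_smul_smul₀ (scalarHom_ne_zero hq r a)]

/-- The quotient datum of a bialgebra map that is injective on `k^H`. -/
def datumOfMap : QuotientDatum k Γ H where
  N := scalarSubgroup q
  normal := ⟨fun r hr s => mem_scalarSubgroup_of_map_basis hq fun h =>
    ⟨_, map_basis_conj hq ⟨r, hr⟩ s h⟩⟩
  stable l r hr := mem_scalarSubgroup_of_map_basis hq fun h =>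
    ⟨_, by simpa only [inv_inv] using map_basis_inv_smul hq ⟨r, hr⟩ l⁻¹ h⟩
  Φ := scalarHom hq
  Φ_mul r l h := by
    rw [scalarHom_eq_of_map_basis hq ⟨l⁻¹ • (r : Γ), _⟩ (map_basis_inv_smul hq r l h),
      div_mul_cancel₀ _ (scalarHom_ne_zero hq r l)]
  Φ_conj r s := by
    refine Units.ext (FunAlg.ext fun h => ?_)
    exact (scalarHom_eq_of_map_basis hq _ (map_basis_conj hq r s h)).symm

theorem map_tmul_phi_datumOfMap {r : Γ} (hr : r ∈ (datumOfMap hq).N) :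
    q (tmul r 1) = q (tmul 1 ((datumOfMap hq).phi r hr)) := map_tmul_scalarHom hq ⟨r, hr⟩

theorem le_datumOfMap {D : QuotientDatum k Γ H}
    (hD : ∀ (r : Γ) (hr : r ∈ D.N), q (tmul r 1) = q (tmul 1 (D.phi r hr))) :
    D ≤ datumOfMap hq := by
  refine ⟨fun r hr => mem_scalarSubgroup_of_map_tmul_eq (hD r hr), fun r => ?_⟩
  refine Units.ext (FunAlg.ext fun h => ?_)
  exact scalarHom_eq_of_map_basis hq _
    ((map_tmul_eq_iff (q : SmashCoproduct k Γ H →ₐ[k] L) r _).1 (hD r r.2) h)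

/-- If `q(r # δ_1)` is a multiple of `q(1 # δ_1)`, then `q(r # 1)` lies in the image of `k^H`. -/
theorem mem_datumOfMap_of_map_basis_one {r : Γ} (hr : q (basis k r 1) = q (basis k 1 1)) :
    r ∈ (datumOfMap hq).N := by
  refine mem_scalarSubgroup_of_map_basis hq fun h => ?_
  -- As 1 = h h⁻¹, this component gives q(r # δ_h) ⊗ q(h⁻¹.r # δ_{h⁻¹}) = q(1 # δ_h) ⊗ q(1 #
  -- δ_{h⁻¹}). Contracting the second factor shows that q(r # δ_h) is a multiple of q(1 # δ_h).
  have h1 := congrArg (comulComponent q h h⁻¹) hr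
  rw [comulComponent_basis, comulComponent_basis, if_pos (mul_inv_cancel h).symm,
    if_pos (mul_inv_cancel h).symm, show h⁻¹ • (1 : Γ) = 1 from smul_one _] at h1
  obtain ⟨f, hf⟩ := Module.Projective.exists_dual_eq_one k (map_basis_ne_zero hq (h⁻¹ • r) h⁻¹)
  have h2 := congrArg ((TensorProduct.rid k L).toLinearMap ∘ₗ TensorProduct.map LinearMap.id f) h1
  exact ⟨f (q (basis k 1 h⁻¹)), by simpa [hf] using h2⟩

/-- The vectors are group-like for the (1, 1) component, and distinct because a coincidence would
put r_i r_{i'}⁻¹ in N. -/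
theorem linearIndependent_map_basis_one {ι : Type*} {r : ι → Γ}
    (hr : Function.Injective fun i => (r i : Γ ⧸ (datumOfMap hq).N)) :
    LinearIndependent k fun i => q (basis k (r i) 1) := by
  have hinj : Function.Injective fun i => q (basis k (r i) 1) := by
    intro i i' h
    apply hr
    have h1 : q (basis k (r i / r i') 1) = q (basis k 1 1) := by
      have h2 := congrArg (· * q (basis k (r i')⁻¹ 1)) h
      simpa only [← map_mul, basis_mul_basis, if_true, ← div_eq_mul_inv, div_self'] using h2
    exact (QuotientGroup.eq_iff_div_mem).2 (mem_datumOfMap_of_map_basis_one hq h1)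
  rw [← linearIndepOn_id_range_iff hinj]
  refine (linearIndepOn_of_map_eq_tmul_self (comulComponent q 1 1)).mono ?_
  rintro _ ⟨i, rfl⟩
  refine ⟨map_basis_ne_zero hq _ _, ?_⟩
  rw [comulComponent_basis, if_pos (mul_one 1).symm, inv_one, one_smul]

/-- The (h, 1) component kills q(r_m # δ_l) for l ≠ h and sends q(r_m # δ_h) to q(r_m # δ_h) ⊗
q(h⁻¹.r_m # δ_1). The second factors are independent by the case h = 1, because h⁻¹ permutes Γ/N. -/
theorem linearIndependent_map_basis {ι : Type*} {r : ι → Γ}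
    (hr : Function.Injective fun i => (r i : Γ ⧸ (datumOfMap hq).N)) :
    LinearIndependent k fun p : ι × H => q (basis k (r p.1) p.2) := by
  classical
  rw [linearIndependent_iff']
  rintro s g hg ⟨i, h⟩ hi
  have hr' : Function.Injective fun i => ((h⁻¹ • r i : Γ) : Γ ⧸ (datumOfMap hq).N) :=
    ((datumOfMap hq).quotAct h⁻¹).injective.comp hr
  obtain ⟨c, hc⟩ := LinearMap.exists_leftInverse_of_injective _
    (LinearMap.ker_eq_bot.2 (linearIndependent_map_basis_one hq hr'))
  have hc' : ∀ m, c (q (basis k (h⁻¹ • r m) 1)) i = if m = i then 1 else 0 := fun m => by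
    have h1 := LinearMap.congr_fun hc (Finsupp.single m 1)
    simp only [LinearMap.comp_apply, Finsupp.linearCombination_single, one_smul,
      LinearMap.id_apply] at h1
    rw [h1, Finsupp.single_apply]
  obtain ⟨f, hf⟩ := Module.Projective.exists_dual_eq_one k (map_basis_ne_zero hq (r i) h)
  -- `c` reads off coordinates in the second factor and `f` is 1 on q(r_i # δ_h), so `e` isolates
  -- the coefficient at (i, h).
  let e : L →ₗ[k] k := Finsupp.lapply i ∘ₗ c ∘ₗ (TensorProduct.lid k L).toLinearMap ∘ₗ
    TensorProduct.map f LinearMap.id ∘ₗ comulComponent q h 1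
  have he : ∀ m l, e (q (basis k (r m) l)) = if (m, l) = (i, h) then 1 else 0 := fun m l => by
    simp only [e, LinearMap.comp_apply, comulComponent_basis, mul_one]
    by_cases hl : l = h
    · subst hl
      by_cases hm : m = i
      · subst hm
        simp [hf, hc']
      · simp [hc', hm]
    · simp [hl]
  have h1 := congrArg e hg
  rw [map_sum, map_zero, Finset.sum_eq_single_of_mem _ hi] at h1
  · simpa [he] using h1
  · rintro ⟨m, l⟩ - hml
    rw [map_smul, he, if_neg hml, smul_zero]

/-- The kernel of `q` is contained in that of the projection attached to any quotient datum
extending that of `q`. -/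
theorem proj_eq_zero_of_map_eq_zero {D : QuotientDatum k Γ H} (hD : datumOfMap hq ≤ D)
    (j : D.Sec) {a : SmashCoproduct k Γ H} (ha : q a = 0) : QuotientDatum.proj j a = 0 := by
  obtain ⟨j'⟩ := (inferInstance : Nonempty (datumOfMap hq).Sec)
  have h1 : datumOfMap hq ∈ compatibleData (q : SmashCoproduct k Γ H →ₐ[k] L) :=
    fun r hr => map_tmul_phi_datumOfMap hq hr
  have h2 : QuotientDatum.proj j' a = 0 := by
    -- This map sends the basis x # δ_h to the independent family q(j'(x) # δ_h), and its composite
    -- with `proj j'` is q.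
    have hinj : Function.Injective
        (QuotientDatum.factorLin (q : SmashCoproduct k Γ H →ₐ[k] L) j') :=
      linearIndependent_map_basis hq (r := j') fun x y hxy => by simpa using hxy
    apply hinj
    rw [QuotientDatum.factorLin_proj h1, map_zero]
    exact ha
  -- Since D extends the datum of q, the projection of D satisfies the relations of that datum,
  -- hence factors through `proj j'`.
  have h3 : datumOfMap hq ∈ compatibleData
      (QuotientDatum.proj j : SmashCoproduct k Γ H →ₐ[k] D.QuotientHopf j) := fun r hr => by
    have h4 := QuotientDatum.proj_tmul j (hD.1 hr)
    rwa [show D.phi r (hD.1 hr) = (datumOfMap hq).phi r hr from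
      congrArg Units.val (hD.2 ⟨r, hr⟩)] at h4
  have h5 := QuotientDatum.factorLin_proj h3 j' a
  rw [h2, map_zero] at h5
  exact h5.symm

end DatumOfMap

end SmashCoproduct

/-! ### Inner faithfulness, the greatest compatible datum and the Hopf image. -/

/-- A bialgebra map through which an inner faithful algebra map factors is injective. -/
theorem IsInnerFaithful.injective_of_comp_eq {k A L R : Type*} [Field k] [Ring A]
    [HopfAlgebra k A] [Ring L] [HopfAlgebra k L] [Ring R] [Algebra k R] {ρ : A →ₐ[k] R}
    (hρ : IsInnerFaithful ρ) (q : A →ₐc[k] L) (φ : L →ₐ[k] R) (hφ : ∀ a, φ (q a) = ρ a) :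
    Function.Injective q := by
  have := q.ker_isHopfIdeal
  -- Inner faithfulness is tested only in the universe of A, so L is replaced by A/ker q.
  let I : Ideal A := RingHom.ker q
  let φ' : A ⧸ I →ₐ[k] R := Ideal.Quotient.liftₐ I ρ fun a ha => by
    rw [← hφ, show q a = 0 from ha, map_zero]
  obtain ⟨f, ⟨hf, -⟩, -⟩ := hρ.2 (A ⧸ I) (Bialgebra.Quotient.mkBialgHom I) φ'
    ⟨Ideal.Quotient.mk_surjective, AlgHom.ext fun a => rfl⟩
  rw [injective_iff_map_eq_zero]
  intro a ha
  have h1 : Bialgebra.Quotient.mkBialgHom (R := k) I a = 0 :=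
    Ideal.Quotient.eq_zero_iff_mem.2 ha
  have h2 := BialgHom.congr_fun hf a
  rw [BialgHom.comp_apply, h1, map_zero] at h2
  exact h2.symm

namespace SmashCoproduct

variable {k Γ H R L : Type*} [Field k] [Group Γ] [Group H] [Fintype H] [DecidableEq H]
  [MulDistribMulAction H Γ] [Ring R] [Algebra k R] [Ring L] [HopfAlgebra k L]
  {ρ : SmashCoproduct k Γ H →ₐ[k] R}

theorem injective_comp_inclBialg (hρ : IsInnerFaithful (ρ.comp (incl k Γ H)))
    {q : SmashCoproduct k Γ H →ₐc[k] L} {φ : L →ₐ[k] R} (hφ : ∀ a, φ (q a) = ρ a) :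
    Function.Injective (q.comp (inclBialg k Γ H)) :=
  hρ.injective_of_comp_eq _ φ fun a => hφ (incl k Γ H a)

theorem datumOfMap_mem_compatibleData {q : SmashCoproduct k Γ H →ₐc[k] L} {φ : L →ₐ[k] R}
    (hφ : ∀ a, φ (q a) = ρ a) (hq : Function.Injective (q.comp (inclBialg k Γ H))) :
    datumOfMap hq ∈ compatibleData ρ := fun r hr => by
  rw [← hφ, ← hφ, map_tmul_phi_datumOfMap hq hr]

/-- The compatible quotient data have a greatest element. -/
theorem exists_isGreatest_compatibleData (hρ : IsInnerFaithful (ρ.comp (incl k Γ H))) :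
    ∃ D, IsGreatest (compatibleData ρ) D := by
  let S : Set (Ideal (SmashCoproduct k Γ H)) :=
    {J | J.IsTwoSided ∧ J.IsHopfIdeal k ∧ J ≤ RingHom.ker ρ}
  -- The largest Hopf ideal inside ker ρ.
  let I := sSup S
  have : I.IsTwoSided := Ideal.isTwoSided_sSup fun J hJ => hJ.1
  have : I.IsHopfIdeal k := Ideal.isHopfIdeal_sSup fun J hJ => hJ.2.1
  have hI : I ≤ RingHom.ker ρ := sSup_le fun J hJ => hJ.2.2
  let q : SmashCoproduct k Γ H →ₐc[k] SmashCoproduct k Γ H ⧸ I :=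
    Bialgebra.Quotient.mkBialgHom I
  let φ : SmashCoproduct k Γ H ⧸ I →ₐ[k] R := Ideal.Quotient.liftₐ I ρ hI
  have hφ : ∀ a, φ (q a) = ρ a := fun a => Ideal.Quotient.liftₐ_apply I ρ _ _
  have hq := injective_comp_inclBialg hρ hφ
  refine ⟨datumOfMap hq, datumOfMap_mem_compatibleData hφ hq, fun D hD => ?_⟩
  refine le_datumOfMap hq fun r hr => ?_
  obtain ⟨j⟩ := (inferInstance : Nonempty D.Sec)
  -- The kernel of the projection of a compatible D is contained in I, so the relations r # 1 ~ 1 #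
  -- Φ(r) already hold modulo I.
  have hJ : RingHom.ker (QuotientDatum.proj j) ∈ S :=
    ⟨inferInstance, (QuotientDatum.proj j).ker_isHopfIdeal, fun a ha => by
      have ha : QuotientDatum.proj j a = 0 := ha
      rw [RingHom.mem_ker, ← QuotientDatum.factorLin_proj hD j, ha, map_zero]⟩
  refine Ideal.Quotient.eq.2 (le_sSup hJ ?_)
  rw [RingHom.mem_ker, map_sub, QuotientDatum.proj_tmul j hr, sub_self]

/-- The factorization attached to the greatest compatible quotient datum is universal. -/
theorem isHopfImage_of_isGreatest (hρ : IsInnerFaithful (ρ.comp (incl k Γ H)))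
    {D : QuotientDatum k Γ H} (hD : IsGreatest (compatibleData ρ) D) (j : D.Sec) :
    IsHopfImage.{w} ρ (QuotientDatum.proj j) (QuotientDatum.factor hD.1 j) := by
  refine ⟨QuotientDatum.isFactorization_proj hD.1 j, fun M _ _ q φ hqφ => ?_⟩
  have hφ : ∀ a, φ (q a) = ρ a := AlgHom.congr_fun hqφ.2
  have hq := injective_comp_inclBialg hρ hφ
  obtain ⟨f, hf⟩ := q.exists_comp_eq_of_ker_le hqφ.1 (QuotientDatum.proj j) fun a ha =>
    proj_eq_zero_of_map_eq_zero hq (hD.2 (datumOfMap_mem_compatibleData hφ hq)) j ha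
  have hf' : ∀ a, f (q a) = QuotientDatum.proj j a := BialgHom.congr_fun hf
  -- Compatibility with φ and uniqueness both follow from the surjectivity of q.
  refine ⟨f, ⟨hf, AlgHom.ext fun b => ?_⟩, fun g hg => BialgHom.ext fun b => ?_⟩
  · obtain ⟨a, rfl⟩ := hqφ.1 b
    rw [hφ]
    change QuotientDatum.factor hD.1 j (f (q a)) = ρ a
    rw [hf']
    exact QuotientDatum.factorLin_proj hD.1 j a
  · obtain ⟨a, rfl⟩ := hqφ.1 b
    rw [hf']
    exact BialgHom.congr_fun hg.1 a

end SmashCoproduct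

end

theorem proposition4p1
    {k : Type*} [Field k] {Γ : Type*} [Group Γ]
    {H : Type*} [Group H] [Fintype H] [DecidableEq H] [MulDistribMulAction H Γ]
    {R : Type*} [Ring R] [Algebra k R]
    (ρ : SmashCoproduct k Γ H →ₐ[k] R)
    (hρ : IsInnerFaithful (ρ.comp (SmashCoproduct.incl k Γ H))) :
    (∀ D ∈ compatibleData ρ, ∀ j : D.Sec,
      ∃ (q : SmashCoproduct k Γ H →ₐc[k] D.QuotientHopf j) (ρ' : D.QuotientHopf j →ₐ[k] R),
        (∀ (r : Γ) (h : H), q (SmashCoproduct.basis k r h) =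
          QuotientDatum.QuotientHopf.tmul j (r : Γ ⧸ D.N)
            (FunAlg.delta k h * D.phi (r * (j (r : Γ ⧸ D.N))⁻¹) (j.mem r))) ∧
        (∀ (x : Γ ⧸ D.N) (h : H), ρ' (QuotientDatum.QuotientHopf.basis j x h) =
          ρ (SmashCoproduct.basis k (j x) h)) ∧
        IsFactorization ρ q ρ' ∧
        (Maximal (· ∈ compatibleData ρ) D → IsHopfImage.{w} ρ q ρ')) ∧
    ∃ D : QuotientDatum k Γ H, Maximal (· ∈ compatibleData ρ) D := by
  obtain ⟨E, hE⟩ := SmashCoproduct.exists_isGreatest_compatibleData hρ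
  refine ⟨fun D hD j => ⟨QuotientDatum.proj j, QuotientDatum.factor hD j, fun r h => ?_,
    fun x h => QuotientDatum.factorLin_basis j x h, QuotientDatum.isFactorization_proj hD j,
    fun hmax => ?_⟩, E, hE.maximal⟩
  · rw [QuotientDatum.proj_basis, QuotientDatum.QuotientHopf.tmul_delta]
    rfl
  -- A maximal element lying below the greatest one equals it.
  · obtain rfl : D = E := hmax.eq_of_le hE.1 (hE.2 hD)
    exact SmashCoproduct.isHopfImage_of_isGreatest hρ hE j
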